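/- Let $T$ be an ergodic automorphism of a non-atomic Lebesgue probability space $(\Omega,\mathcal S,\mu)$. Let $\|\cdot\|$ be the Euclidean operator norm, let $N:\mathrm{GL}_2(\mathbb R)\to\mathbb R$ be a locally bounded function with $N(g)\ge\log\max(\|g\|,\|g^{-1}\|)$ for all $g$, let $r_1>r_2$ be real numbers, and let $\eta$ be a Borel probability measure on $\mathsf X=\{(x_1,x_2)\in\mathbb R\mathrm P^1\times\mathbb R\mathrm P^1: x_1\ne x_2\}$. For a measurable map $F:\Omega\to\mathrm{GL}_2(\mathbb R)$ and $n\in\mathbb Z$ let $F^{(n)}(\omega)$ denote the cocycle with $F^{(n)}(\omega)=F(T^{n-1}\omega)\cdots F(T\omega)F(\omega)$ for $n>0$, $F^{(0)}(\omega)=\mathrm{Id}$ and $F^{(-n)}(\omega)=F^{(n)}(T^{-n}\omega)^{-1}$ for $n>0$. Then there exists a measurable map $F:\Omega\to\mathrm{GL}_2(\mathbb R)$ such that: 1. $\int_\Omega N(F(\omega))\,d\mu(\omega)<\infty$ (if $N\circ F$ is not measurable, the integral is understood as the upper integral, that is, $N\circ F$ is dominated by an integrable function); 2. the Lyapunov exponents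 of $(T,F)$ are $r_1,r_2$: for $\mu$-a.e. $\omega$, as $n\to+\infty$, $\frac1n\log\|F^{(n)}(\omega)\|\to r_1$ and $\frac1n\log\big(\|F^{(n)}(\omega)^{-1}\|^{-1}\big)\to r_2$; 3. for $\mu$-a.e. $\omega$ the Oseledets spaces $$\mathbf E_j(\omega)=\Big\{v\in\mathbb R^2: v=0\ \text{ or }\ \lim_{|n|\to\infty}\tfrac1n\log\|F^{(n)}(\omega)v\|=r_j\Big\},\qquad j=1,2,$$ are two distinct lines, they depend measurably on $\omega$ (after modification on a null set), and their joint distribution is exactly $\eta$: the push-forward of $\mu$ under $\omega\mapsto(\mathbf E_1(\omega),\mathbf E_2(\omega))\in\mathsf X$ is $\eta$. -/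

import Mathlib

open MeasureTheory Filter Topology
open scoped ENNReal LinearAlgebra.Projectivization

noncomputable section

/-- The Euclidean plane `ℝ²`. -/
abbrev Plane : Type := EuclideanSpace ℝ (Fin 2)

/-- The real projective line `ℝP¹`: the space of lines through the origin of `ℝ²`. -/
abbrev RP1 : Type := ℙ ℝ Plane

/-- `ℝP¹` has the quotient topology of `ℝ² ∖ {0}`. -/
instance RP1.instTopologicalSpace : TopologicalSpace RP1 :=
  TopologicalSpace.coinduced (Projectivization.mk' ℝ : {v : Plane // v ≠ 0} → RP1) inferInstance

/-- The space of ordered pairs of distinct lines of `ℝ²`, that is, `ℝP¹ × ℝP¹` minus the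
diagonal. -/
def LinePairs : Type := {p : RP1 × RP1 // p.1 ≠ p.2}

/-- The topology of `LinePairs` is the one induced by the product topology. -/
instance LinePairs.instTopologicalSpace : TopologicalSpace LinePairs :=
  inferInstanceAs (TopologicalSpace {p : RP1 × RP1 // p.1 ≠ p.2})

/-- `LinePairs` carries its Borel σ-algebra. -/
instance LinePairs.instMeasurableSpace : MeasurableSpace LinePairs := borel LinePairs

instance LinePairs.instBorelSpace : BorelSpace LinePairs := ⟨rfl⟩

/-- The first line of a pair, as a linear subspace of `ℝ²`. -/
def LinePairs.fst (x : LinePairs) : Submodule ℝ Plane := x.1.1.submodule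

/-- The second line of a pair, as a linear subspace of `ℝ²`. -/
def LinePairs.snd (x : LinePairs) : Submodule ℝ Plane := x.1.2.submodule

/-- `GL₂(ℝ)`, with its usual topology, carries its Borel σ-algebra. -/
instance GL2.instMeasurableSpace : MeasurableSpace (GL (Fin 2) ℝ) := borel (GL (Fin 2) ℝ)

instance GL2.instBorelSpace : BorelSpace (GL (Fin 2) ℝ) := ⟨rfl⟩

/-- The linear automorphism of the Euclidean plane with matrix `g`. -/
def glAct (g : GL (Fin 2) ℝ) : Plane →L[ℝ] Plane :=
  Matrix.toEuclideanCLM (n := Fin 2) (𝕜 := ℝ) (g : Matrix (Fin 2) (Fin 2) ℝ)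

/-- The Euclidean operator norm of `g`, which is its largest singular value. -/
def glNorm (g : GL (Fin 2) ℝ) : ℝ := ‖glAct g‖

/-- `N` is bounded on a neighbourhood of each point. -/
def IsLocallyBounded {X : Type*} [TopologicalSpace X] (N : X → ℝ) : Prop :=
  ∀ x, ∃ U ∈ 𝓝 x, ∃ C : ℝ, ∀ y ∈ U, |N y| ≤ C

/-- `(Ω, μ)` is a non-atomic Lebesgue probability space: up to null sets, and with measurability
understood with respect to the completed σ-algebras, it is isomorphic to the unit interval with
Lebesgue measure. The maps `φ` and `ψ` are inverse bijections between the conull sets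
`{ω | ψ (φ ω) = ω}` and `{t | φ (ψ t) = t}`. When the σ-algebra of `Ω` is complete,
`NullMeasurable φ μ` just says that `φ` is measurable. -/
def IsNonatomicLebesgueSpace {Ω : Type*} [MeasurableSpace Ω] (μ : Measure Ω) : Prop :=
  ∃ (φ : Ω → unitInterval) (ψ : unitInterval → Ω),
    NullMeasurable φ μ ∧ NullMeasurable ψ (volume : Measure unitInterval) ∧
    (∀ s : Set unitInterval, MeasurableSet s → μ (φ ⁻¹' s) = volume s) ∧
    (∀ s : Set Ω, MeasurableSet s → volume (ψ ⁻¹' s) = μ s) ∧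
    (∀ᵐ ω ∂μ, ψ (φ ω) = ω) ∧ (∀ᵐ t : unitInterval, φ (ψ t) = t)

/-- The upper integral of a nonnegative function that need not be measurable. -/
def upperIntegral {Ω : Type*} [MeasurableSpace Ω] (μ : Measure Ω) (f : Ω → ℝ≥0∞) : ℝ≥0∞ :=
  ⨅ (g : Ω → ℝ≥0∞) (_ : Measurable g) (_ : f ≤ g), ∫⁻ ω, g ω ∂μ

/-- For measurable functions the upper integral is the Lebesgue integral. -/
theorem upperIntegral_eq_lintegral {Ω : Type*} [MeasurableSpace Ω] (μ : Measure Ω)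
    {f : Ω → ℝ≥0∞} (hf : Measurable f) : upperIntegral μ f = ∫⁻ ω, f ω ∂μ :=
  le_antisymm (iInf_le_of_le f (iInf_le_of_le hf (iInf_le _ le_rfl)))
    (le_iInf fun _ => le_iInf fun _ => le_iInf fun h => lintegral_mono h)

section Cocycle

variable {Ω : Type*} [MeasurableSpace Ω]

/-- The product `F (T^(n-1) ω) ⋯ F (T ω) F (ω)` of `n` factors. -/
def cocycleNat (T : Ω ≃ᵐ Ω) (F : Ω → GL (Fin 2) ℝ) : ℕ → Ω → GL (Fin 2) ℝ
  | 0, _ => 1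
  | n + 1, ω => F (T^[n] ω) * cocycleNat T F n ω

/-- The cocycle `F⁽ⁿ⁾(ω)`, `n ∈ ℤ`, generated by `F` over `T`. For negative times,
`F⁽⁻ⁿ⁾(ω) = (F⁽ⁿ⁾(T⁻ⁿ ω))⁻¹`, as the cocycle identity requires. -/
def cocycle (T : Ω ≃ᵐ Ω) (F : Ω → GL (Fin 2) ℝ) : ℤ → Ω → GL (Fin 2) ℝ
  | Int.ofNat n, ω => cocycleNat T F n ω
  | Int.negSucc n, ω => (cocycleNat T F (n + 1) (T.symm^[n + 1] ω))⁻¹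

/-- The Lyapunov exponents of `(T, F)` are `r₁` and `r₂`: for almost every `ω`, these are the
exponential growth rates of the singular values `‖F⁽ⁿ⁾(ω)‖` and `‖F⁽ⁿ⁾(ω)⁻¹‖⁻¹`. -/
def HasLyapunovExponents (μ : Measure Ω) (T : Ω ≃ᵐ Ω) (F : Ω → GL (Fin 2) ℝ) (r₁ r₂ : ℝ) : Prop :=
  ∀ᵐ ω ∂μ,
    Tendsto (fun n : ℕ => (1 / (n : ℝ)) * Real.log (glNorm (cocycle T F n ω))) atTop (𝓝 r₁) ∧
    Tendsto (fun n : ℕ => (1 / (n : ℝ)) * Real.log ((glNorm ((cocycle T F n ω)⁻¹))⁻¹)) atTop (𝓝 r₂)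

/-- The Oseledets space at `ω` for the exponent `r`: the vectors `v` that are zero or satisfy
`(1/n) log ‖F⁽ⁿ⁾(ω) v‖ → r` as `|n| → ∞`, that is, both for `n → +∞` and for `n → -∞`. -/
def oseledetsSpace (T : Ω ≃ᵐ Ω) (F : Ω → GL (Fin 2) ℝ) (r : ℝ) (ω : Ω) : Set Plane :=
  {v | v = 0 ∨ Tendsto (fun n : ℤ => (1 / (n : ℝ)) * Real.log ‖glAct (cocycle T F n ω) v‖)
    (atBot ⊔ atTop) (𝓝 r)}

/-- The Oseledets spaces for the exponents `r₁`, `r₂` are (almost everywhere) two distinct lines,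
which depend measurably on the point, and their joint distribution is `η`. -/
def OseledetsJointDistribution (μ : Measure Ω) (T : Ω ≃ᵐ Ω) (F : Ω → GL (Fin 2) ℝ) (r₁ r₂ : ℝ)
    (η : Measure LinePairs) : Prop :=
  ∃ E : Ω → LinePairs, Measurable E ∧
    (∀ᵐ ω ∂μ, oseledetsSpace T F r₁ ω = ((E ω).fst : Set Plane) ∧
      oseledetsSpace T F r₂ ω = ((E ω).snd : Set Plane)) ∧
    μ.map E = η

end Cocycle

end

/-! Choose a random pair of lines `x ω` with law `η` and let `F ω` carry the lines of `x ω` to those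
of `x (T ω)`, stretching their unit vectors by `exp (a χ ω)` and `exp (b χ ω)`. Such matrices
telescope: `F⁽ⁿ⁾ ω` carries the lines of `x ω` to those of `x (Tⁿ ω)`, with the Birkhoff sums of `χ`
in the exponents. Birkhoff's theorem then gives the growth along both lines, and the lines of `x ω`
are the Oseledets spaces.

The difficulty is integrability, since `η` may charge pairs arbitrarily close to the diagonal, where
`N` of these matrices can be huge. So `x` is made to change rarely along orbits, the more rarely the
closer the pairs are to the diagonal. Moreover `χ` is the indicator of `x ω ∈ L 0`, where `L 0` is
compact of mass `p > 0`, and `a = r₁ / p`, `b = r₂ / p`. Where `x` does not change, `F` is the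
identity or lies in a compact set. Where it changes at level `k`, `N ∘ F` is at most a constant `c
k`, fixed beforehand, and this happens with probability at most `2⁻ᵏ / (c k + 1)`.

Two lemmas produce `x`. `exists_rarely_changing` builds a level `R` and an atomless label `h`, with
any prescribed bound on the frequency of changes at each level. `exists_realization` then turns `R +
h` into a variable of law `ν`, by monotone transport to a line on which `Θ` is ordered by closeness
to the diagonal; the result lies in the compact set number `R + 1`.

The integrable majorant of `N ∘ F` also dominates the logarithm of the angle between the lines after
each change. Hence this logarithm is sublinear along orbits, and the angle does not affect the
exponent of `‖F⁽ⁿ⁾(ω)⁻¹‖⁻¹`. -/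

/-! ### Birkhoff's ergodic theorem for bounded functions -/

/-- The running maximum of `0` and the first `n` Birkhoff sums of `f`. -/
def birkhoffMax {Ω : Type*} (T : Ω → Ω) (f : Ω → ℝ) : ℕ → Ω → ℝ
  | 0, _ => 0
  | n + 1, ω => max 0 (f ω + birkhoffMax T f n (T ω))

section Birkhoff

variable {Ω : Type*} {T : Ω → Ω} {f : Ω → ℝ}

theorem birkhoffMax_nonneg (n : ℕ) (ω : Ω) : 0 ≤ birkhoffMax T f n ω := by
  cases n <;> simp [birkhoffMax]

theorem birkhoffMax_le_succ (n : ℕ) (ω : Ω) : birkhoffMax T f n ω ≤ birkhoffMax T f (n + 1) ω := by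
  induction n generalizing ω with
  | zero => simp [birkhoffMax]
  | succ n ih => exact max_le_max le_rfl (add_le_add le_rfl (ih _))

theorem birkhoffSum_le_birkhoffMax (n : ℕ) (ω : Ω) : birkhoffSum T f n ω ≤ birkhoffMax T f n ω := by
  induction n generalizing ω with
  | zero => simp [birkhoffMax]
  | succ n ih =>
    rw [birkhoffSum_succ']
    exact (add_le_add le_rfl (ih _)).trans (le_max_right _ _)

theorem birkhoffMax_le {C : ℝ} (hC : ∀ ω, |f ω| ≤ C) (n : ℕ) (ω : Ω) :
    birkhoffMax T f n ω ≤ n * C := by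
  have hC0 : 0 ≤ C := (abs_nonneg _).trans (hC ω)
  induction n generalizing ω with
  | zero => simp [birkhoffMax]
  | succ n ih =>
    refine max_le (by positivity) ?_
    push_cast
    linarith [ih (T ω), (abs_le.1 (hC ω)).2]

theorem measurable_birkhoffMax [MeasurableSpace Ω] (hT : Measurable T) (hf : Measurable f) (n : ℕ) :
    Measurable (birkhoffMax T f n) := by
  induction n with
  | zero => exact measurable_const
  | succ n ih => exact measurable_const.max (hf.add (ih.comp hT))

variable [MeasurableSpace Ω] {μ : Measure Ω} [IsProbabilityMeasure μ]

/-- Over an ergodic transformation, the Birkhoff sums of a bounded function of negative mean are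
almost everywhere bounded above. -/
theorem ae_bddAbove_birkhoffSum (hT : Ergodic T μ) (hf : Measurable f) {C : ℝ}
    (hC : ∀ ω, |f ω| ≤ C) (hneg : ∫ ω, f ω ∂μ < 0) :
    ∀ᵐ ω ∂μ, ∃ M : ℝ, ∀ n, birkhoffSum T f n ω ≤ M := by
  have hTm := hT.measurable
  have hM := measurable_birkhoffMax hTm hf
  set A : Set Ω := {ω | ∃ m : ℕ, ∀ n, birkhoffMax T f n ω ≤ m} with hA
  have hAm : MeasurableSet A := by
    have : A = ⋃ m : ℕ, ⋂ n, {ω | birkhoffMax T f n ω ≤ m} := by ext; simp [hA]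
    rw [this]
    exact .iUnion fun m => .iInter fun n => measurableSet_le (hM n) measurable_const
  -- By the recursion, boundedness of the running maxima at `ω` and at `T ω` are equivalent, so
  -- ergodicity leaves only the case in which they are almost everywhere unbounded.
  have hAinv : T ⁻¹' A = A := by
    ext ω
    simp only [hA, Set.mem_preimage, Set.mem_ofPred_eq]
    constructor
    · rintro ⟨m, hm⟩
      obtain ⟨k, hk⟩ := exists_nat_ge (max 0 (f ω + m))
      refine ⟨k, fun n => (birkhoffMax_le_succ n ω).trans (le_trans ?_ hk)⟩
      exact max_le_max le_rfl (add_le_add le_rfl (hm n))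
    · rintro ⟨m, hm⟩
      obtain ⟨k, hk⟩ := exists_nat_ge (m - f ω)
      refine ⟨k, fun n => ?_⟩
      have : f ω + birkhoffMax T f n (T ω) ≤ m := (le_max_right _ _).trans (hm (n + 1))
      linarith
  rcases hT.ae_mem_or_ae_notMem hAm hAinv with h | h
  · filter_upwards [h] with ω hω
    obtain ⟨m, hm⟩ := hω
    exact ⟨m, fun n => (birkhoffSum_le_birkhoffMax n ω).trans (hm n)⟩
  exfalso
  have hint : ∀ n, Integrable (birkhoffMax T f n) μ := fun n =>
    Integrable.of_bound (hM n).aestronglyMeasurable (n * C) (.of_forall fun ω => by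
      rw [Real.norm_of_nonneg (birkhoffMax_nonneg n ω)]; exact birkhoffMax_le hC n ω)
  have hmp := hT.toMeasurePreserving
  -- Once the maximum at `T ω` exceeds `-f ω`, the outer `max` with `0` is inactive and the
  -- difference equals `f ω`. The integrals of the differences are nonnegative by monotonicity in
  -- `n` and invariance of `μ`, which contradicts the negative mean.
  have hlim : Tendsto (fun n => ∫ ω, (birkhoffMax T f (n + 1) ω - birkhoffMax T f n (T ω)) ∂μ) atTop
      (𝓝 (∫ ω, f ω ∂μ)) := by
    refine tendsto_integral_of_dominated_convergence (fun _ => C)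
      (fun n => ((hM (n + 1)).sub ((hM n).comp hTm)).aestronglyMeasurable) (integrable_const _)
      (fun n => .of_forall fun ω => ?_) ?_
    · have h0 := birkhoffMax_nonneg (T := T) (f := f) n (T ω)
      have h1 := abs_le.1 (hC ω)
      rw [Real.norm_eq_abs, abs_le, birkhoffMax]
      rcases max_cases 0 (f ω + birkhoffMax T f n (T ω)) with h | h <;>
        constructor <;> linarith
    · filter_upwards [h] with ω hω
      have hω' : T ω ∉ A := by rwa [← Set.mem_preimage, hAinv]
      simp only [hA, Set.mem_ofPred_eq, not_exists, not_forall, not_le] at hω'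
      obtain ⟨k, hk⟩ := exists_nat_ge (-f ω)
      obtain ⟨n, hn⟩ := hω' k
      refine tendsto_const_nhds.congr' ?_
      filter_upwards [eventually_ge_atTop n] with i hi
      have : birkhoffMax T f n (T ω) ≤ birkhoffMax T f i (T ω) :=
        monotone_nat_of_le_succ (fun j => birkhoffMax_le_succ j (T ω)) hi
      rw [birkhoffMax, max_eq_right (by linarith)]
      ring
  refine absurd (ge_of_tendsto' hlim fun n => ?_) (not_le.2 hneg)
  have hcomp : ∫ ω, birkhoffMax T f n (T ω) ∂μ = ∫ ω, birkhoffMax T f n ω ∂μ := by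
    have := integral_map (μ := μ) hTm.aemeasurable
      (f := birkhoffMax T f n) (hM n).aestronglyMeasurable
    rw [hmp.map_eq] at this
    exact this.symm
  have hint' : Integrable (fun ω => birkhoffMax T f n (T ω)) μ :=
    hmp.integrable_comp_of_integrable (hint n)
  rw [integral_sub (hint _) hint', hcomp]
  exact sub_nonneg.2 (integral_mono (hint _) (hint _) fun ω => birkhoffMax_le_succ n ω)

/-- An upper bound for the Birkhoff averages of a bounded function. -/
theorem ae_eventually_birkhoffSum_le (hT : Ergodic T μ) (hf : Measurable f) {C : ℝ}
    (hC : ∀ ω, |f ω| ≤ C) {c : ℝ} (hc : ∫ ω, f ω ∂μ < c) :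
    ∀ᵐ ω ∂μ, ∀ᶠ n : ℕ in atTop, birkhoffSum T f n ω / n < c := by
  -- The sums of `f - d` are bounded above, so the averages of `f` exceed `d` by at most `M / n`,
  -- eventually less than `c - d`.
  obtain ⟨d, hd, hdc⟩ := exists_between hc
  have hint : Integrable f μ := Integrable.of_bound hf.aestronglyMeasurable C (.of_forall hC)
  have := ae_bddAbove_birkhoffSum (f := fun ω => f ω - d) hT (hf.sub_const d) (C := C + |d|)
    (fun ω => (abs_sub _ _).trans (add_le_add (hC ω) le_rfl))
    (by rw [integral_sub hint (integrable_const _)]; simpa using hd)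
  filter_upwards [this] with ω ⟨M, hM⟩
  have hlim : Tendsto (fun n : ℕ => M / n) atTop (𝓝 0) := tendsto_const_div_atTop_nhds_zero_nat M
  filter_upwards [hlim.eventually (gt_mem_nhds (sub_pos.2 hdc)), eventually_gt_atTop 0] with n hn h0
  have hn0 : (0 : ℝ) < n := by exact_mod_cast h0
  have h1 := hM n
  simp only [birkhoffSum, Finset.sum_sub_distrib, Finset.sum_const, Finset.card_range,
    nsmul_eq_mul] at h1
  rw [div_lt_iff₀ hn0] at hn ⊢
  simp only [birkhoffSum]
  nlinarith

/-- Birkhoff's pointwise ergodic theorem for bounded functions. -/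
theorem ae_tendsto_birkhoffSum_div (hT : Ergodic T μ) (hf : Measurable f) {C : ℝ}
    (hC : ∀ ω, |f ω| ≤ C) :
    ∀ᵐ ω ∂μ, Tendsto (fun n : ℕ => birkhoffSum T f n ω / n) atTop (𝓝 (∫ ω, f ω ∂μ)) := by
  have hpos : ∀ k : ℕ, (0 : ℝ) < 1 / ((k : ℝ) + 1) := fun k => Nat.one_div_pos_of_nat
  have h1 := ae_all_iff.2 fun k : ℕ =>
    ae_eventually_birkhoffSum_le hT hf hC (lt_add_of_pos_right (∫ ω, f ω ∂μ) (hpos k))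
  have h2 := ae_all_iff.2 fun k : ℕ =>
    ae_eventually_birkhoffSum_le (f := fun ω => - f ω) (μ := μ) (C := C) hT hf.neg
      (fun ω => by rw [abs_neg]; exact hC ω)
      (c := -(∫ ω, f ω ∂μ) + 1 / ((k : ℝ) + 1))
      (by rw [integral_neg]; exact lt_add_of_pos_right _ (hpos k))
  filter_upwards [h1, h2] with ω h1 h2
  rw [tendsto_order]
  constructor
  · intro a ha
    obtain ⟨k, hk⟩ := exists_nat_one_div_lt (sub_pos.2 ha)
    filter_upwards [h2 k] with n hn
    simp only [birkhoffSum, Finset.sum_neg_distrib, neg_div] at hn ⊢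
    linarith
  · intro a ha
    obtain ⟨k, hk⟩ := exists_nat_one_div_lt (sub_pos.2 ha)
    filter_upwards [h1 k] with n hn
    linarith

/-- An integrable function is almost everywhere sublinear along orbits. -/
theorem ae_eventually_comp_iterate_le (hT : MeasurePreserving T μ μ) {g : Ω → ℝ}
    (hg : Measurable g) (hgi : Integrable g μ) {c : ℝ} (hc : 0 < c) :
    ∀ᵐ ω ∂μ, ∀ᶠ n : ℕ in atTop, g (T^[n] ω) ≤ c * n := by
  -- Borel–Cantelli: by invariance the sum is the mean number of `n` below `g / c`, which is at most
  -- the mean of `|g| / c + 1`.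
  have hsum : ∑' n : ℕ, μ {ω | c * n < g (T^[n] ω)} ≠ ∞ := by
    have hn : ∀ n : ℕ, μ {ω | c * n < g (T^[n] ω)} = μ {ω | (n : ℝ) < g ω / c} := fun n => by
      have : {ω | c * n < g (T^[n] ω)} = T^[n] ⁻¹' {ω | (n : ℝ) < g ω / c} := by
        ext ω; simp [lt_div_iff₀ hc, mul_comm]
      rw [this, (hT.iterate n).measure_preimage
        (measurableSet_lt measurable_const (hg.div_const c)).nullMeasurableSet]
    simp_rw [hn]
    have hle : ∀ ω, ∑' n : ℕ, {ω | (n : ℝ) < g ω / c}.indicator (fun _ => (1 : ℝ≥0∞)) ω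
        ≤ ENNReal.ofReal (|g ω| / c) + 1 := fun ω => by
      have hs : ∀ n ∉ Finset.range ⌈|g ω| / c⌉₊,
          {ω | (n : ℝ) < g ω / c}.indicator (fun _ => (1 : ℝ≥0∞)) ω = 0 := fun n hn => by
        rw [Finset.mem_range, not_lt, Nat.ceil_le] at hn
        refine Set.indicator_of_notMem (fun h => ?_) _
        have h : (n : ℝ) < g ω / c := h
        have := div_le_div_of_nonneg_right (le_abs_self (g ω)) hc.le
        linarith
      rw [tsum_eq_sum hs]
      calc ∑ n ∈ Finset.range ⌈|g ω| / c⌉₊,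
            {ω | (n : ℝ) < g ω / c}.indicator (fun _ => (1 : ℝ≥0∞)) ω
          ≤ ∑ n ∈ Finset.range ⌈|g ω| / c⌉₊, 1 :=
            Finset.sum_le_sum fun n _ => Set.indicator_le_self' (fun _ _ => by simp) _
        _ = ENNReal.ofReal (⌈|g ω| / c⌉₊ : ℝ) := by simp
        _ ≤ ENNReal.ofReal (|g ω| / c + 1) :=
            ENNReal.ofReal_le_ofReal (Nat.ceil_lt_add_one (by positivity)).le
        _ = _ := by rw [ENNReal.ofReal_add (by positivity) zero_le_one, ENNReal.ofReal_one]
    have hmeas : ∀ n : ℕ, MeasurableSet {ω | (n : ℝ) < g ω / c} := fun n =>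
      measurableSet_lt measurable_const (hg.div_const c)
    refine ne_top_of_le_ne_top (b := ∫⁻ ω, ENNReal.ofReal (|g ω| / c) ∂μ + 1)
      (ENNReal.add_ne_top.2 ⟨(hgi.abs.div_const c).lintegral_lt_top.ne, by simp⟩) ?_
    calc _ = ∑' n : ℕ, ∫⁻ ω, {ω | (n : ℝ) < g ω / c}.indicator (fun _ => (1 : ℝ≥0∞)) ω ∂μ := by
          simp [lintegral_indicator, hmeas]
      _ = ∫⁻ ω, ∑' n : ℕ, {ω | (n : ℝ) < g ω / c}.indicator (fun _ => (1 : ℝ≥0∞)) ω ∂μ :=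
          (lintegral_tsum fun n => (measurable_const.indicator (hmeas n)).aemeasurable).symm
      _ ≤ ∫⁻ ω, (ENNReal.ofReal (|g ω| / c) + 1) ∂μ := lintegral_mono hle
      _ = ∫⁻ ω, ENNReal.ofReal (|g ω| / c) ∂μ + 1 := by
          rw [lintegral_add_right _ measurable_const]; simp
  filter_upwards [ae_eventually_notMem hsum] with ω hω
  filter_upwards [hω] with n hn
  simpa using hn

end Birkhoff

/-! ### Functions that change rarely along orbits -/

/-- The points that visit `B` before time `n`. -/
def visitSet {Ω : Type*} (T : Ω → Ω) (B : Set Ω) (n : ℕ) : Set Ω := {ω | ∃ i < n, T^[i] ω ∈ B}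

open Classical in
/-- The first time at which `ω` visits `B`, and `0` if it never does. -/
noncomputable def firstVisit {Ω : Type*} (T : Ω → Ω) (B : Set Ω) (ω : Ω) : ℕ :=
  if h : ∃ n, T^[n] ω ∈ B then Nat.find h else 0

section Visits

variable {Ω : Type*} {T : Ω → Ω} {B : Set Ω}

/-- The time windows `[0, n)` and `[1, n]` differ only at the times `0` and `n`. -/
theorem mem_or_iterate_mem_of_visitSet_ne {n : ℕ} {ω : Ω}
    (h : ¬(ω ∈ visitSet T B n ↔ T ω ∈ visitSet T B n)) : ω ∈ B ∨ T^[n] ω ∈ B := by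
  by_contra! hc
  refine h ⟨?_, ?_⟩
  · rintro ⟨i, hi, hB⟩
    cases i with
    | zero => exact absurd hB hc.1
    | succ i => exact ⟨i, by omega, hB⟩
  · rintro ⟨i, hi, hB⟩
    rcases Nat.lt_or_ge (i + 1) n with h1 | h1
    · exact ⟨i + 1, h1, hB⟩
    · obtain rfl : n = i + 1 := by omega
      exact absurd hB hc.2

theorem iterate_firstVisit_map {ω : Ω} (hω : ω ∉ B) (h : ∃ n, T^[n] ω ∈ B) :
    T^[firstVisit T B (T ω)] (T ω) = T^[firstVisit T B ω] ω := by
  classical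
  obtain ⟨n, hn⟩ := h
  have h' : ∃ n, T^[n] (T ω) ∈ B := by
    cases n with
    | zero => exact absurd hn hω
    | succ n => exact ⟨n, hn⟩
  have h : ∃ n, T^[n] ω ∈ B := ⟨n, hn⟩
  have : Nat.find h = Nat.find h' + 1 := Nat.find_comp_succ h h' hω
  rw [firstVisit, firstVisit, dif_pos h, dif_pos h', this, Function.iterate_succ_apply]

variable [MeasurableSpace Ω] {μ : Measure Ω} [IsProbabilityMeasure μ]

theorem measurableSet_visitSet (hT : Measurable T) (hB : MeasurableSet B) (n : ℕ) :
    MeasurableSet (visitSet T B n) := by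
  have : visitSet T B n = ⋃ i < n, T^[i] ⁻¹' B := by ext; simp [visitSet]
  rw [this]
  exact .biUnion (Set.to_countable _) fun i _ => hT.iterate i hB

theorem measurable_iterate_firstVisit (hT : Measurable T) (hB : MeasurableSet B) :
    Measurable fun ω => T^[firstVisit T B ω] ω := by
  classical
  have hp : ∀ ω, ∃ n, T^[n] ω ∈ B ∨ ∀ m, T^[m] ω ∉ B := fun ω => by
    by_cases h : ∃ n, T^[n] ω ∈ B
    · exact h.imp fun n => Or.inl
    · exact ⟨0, Or.inr (not_exists.1 h)⟩
  have heq : (fun ω => T^[firstVisit T B ω] ω) = fun ω => T^[Nat.find (hp ω)] ω := by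
    ext ω
    rw [firstVisit]
    split_ifs with h
    · have : Nat.find h = Nat.find (hp ω) := Nat.find_congr' fun {n} => by
        simp only [iff_self_or]
        exact fun h' => absurd h (not_exists.2 h')
      rw [this]
    · have : Nat.find (hp ω) = 0 := by
        rw [Nat.find_eq_zero]; exact Or.inr (not_exists.1 h)
      rw [this]
  rw [heq]
  have hset : ∀ n, MeasurableSet {ω | T^[n] ω ∈ B ∨ ∀ m, T^[m] ω ∉ B} := fun n => by
    have : {ω | T^[n] ω ∈ B ∨ ∀ m, T^[m] ω ∉ B} = T^[n] ⁻¹' B ∪ ⋂ m, (T^[m] ⁻¹' B)ᶜ := by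
      ext; simp
    rw [this]
    exact (hT.iterate n hB).union (.iInter fun m => (hT.iterate m hB).compl)
  exact Measurable.find (f := fun n => T^[n]) (fun n => hT.iterate n) hset hp

/-- The set of points that ever visit `B` contains its own preimage, so it is null or conull; it
contains `B`. -/
theorem ae_exists_iterate_mem (hT : Ergodic T μ) (hB : MeasurableSet B) (h0 : 0 < μ B) :
    ∀ᵐ ω ∂μ, ∃ n, T^[n] ω ∈ B := by
  have hm : MeasurableSet (⋃ n, T^[n] ⁻¹' B) := .iUnion fun n => hT.measurable.iterate n hB
  have hsub : T ⁻¹' (⋃ n, T^[n] ⁻¹' B) ⊆ ⋃ n, T^[n] ⁻¹' B := by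
    intro ω hω
    obtain ⟨n, hn⟩ := Set.mem_iUnion.1 hω
    exact Set.mem_iUnion.2 ⟨n + 1, hn⟩
  rcases hT.ae_empty_or_univ_of_preimage_ae_le hm.nullMeasurableSet hsub.eventuallyLE with h | h
  · have h1 : μ B ≤ μ (⋃ n, T^[n] ⁻¹' B) := measure_mono (Set.subset_iUnion_of_subset 0 (by simp))
    rw [measure_congr h, measure_empty] at h1
    exact absurd h0 (not_lt.2 h1)
  · filter_upwards [h.mem_iff] with ω hω
    simpa using hω

/-- The measure of `visitSet T B n` starts at `0`, tends to `1` and grows by at most `μ B` at each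
step, so at the first time it reaches `a` the overshoot is at most `μ B`. -/
theorem exists_measure_visitSet (hT : Ergodic T μ) (hB : MeasurableSet B) (h0 : 0 < μ B)
    {a : ℝ≥0∞} (ha : a < 1) :
    ∃ n, a ≤ μ (visitSet T B n) ∧ μ (visitSet T B n) ≤ a + μ B := by
  classical
  have hmono : Monotone (visitSet T B) := fun m n hmn ω ⟨i, hi, h⟩ => ⟨i, hi.trans_le hmn, h⟩
  have hone : μ (⋃ n, visitSet T B n) = 1 := by
    rw [prob_compl_eq_zero_iff (.iUnion fun n => measurableSet_visitSet hT.measurable hB n) |>.symm]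
    filter_upwards [ae_exists_iterate_mem hT hB h0] with ω ⟨n, hn⟩
    exact Set.mem_iUnion.2 ⟨n + 1, n, n.lt_succ_self, hn⟩
  have hex : ∃ n, a ≤ μ (visitSet T B n) := by
    have := tendsto_measure_iUnion_atTop (μ := μ) hmono
    rw [hone] at this
    obtain ⟨n, hn⟩ := (this.eventually (lt_mem_nhds ha)).exists
    exact ⟨n, hn.le⟩
  refine ⟨Nat.find hex, Nat.find_spec hex, ?_⟩
  rcases h : Nat.find hex with _ | m
  · simp [visitSet]
  · have hm : μ (visitSet T B m) < a := not_le.1 (Nat.find_min hex (h ▸ m.lt_succ_self))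
    have hsub : visitSet T B (m + 1) ⊆ visitSet T B m ∪ T^[m] ⁻¹' B := by
      rintro ω ⟨i, hi, hB⟩
      rcases Nat.lt_succ_iff_lt_or_eq.1 hi with h1 | rfl
      · exact Or.inl ⟨i, h1, hB⟩
      · exact Or.inr hB
    calc μ (visitSet T B (m + 1)) ≤ μ (visitSet T B m) + μ (T^[m] ⁻¹' B) :=
          (measure_mono hsub).trans (measure_union_le _ _)
      _ ≤ a + μ B := by
          rw [(hT.toMeasurePreserving.iterate m).measure_preimage hB.nullMeasurableSet]
          exact add_le_add hm.le le_rfl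

/-- A pair `(R, h)` of functions that changes arbitrarily rarely along the orbits of `T`, the more
rarely the larger `R` is. -/
theorem exists_rarely_changing (hT : Ergodic T μ) {φ : Ω → ℝ} (hφ : Measurable φ)
    (hφ01 : ∀ ω, φ ω ∈ Set.Icc (0 : ℝ) 1) (hφa : ∀ c, μ (φ ⁻¹' {c}) = 0)
    (hsmall : ∀ δ : ℝ≥0∞, 0 < δ → ∃ B, MeasurableSet B ∧ 0 < μ B ∧ μ B ≤ δ)
    {ε : ℕ → ℝ≥0∞} (hε : ∀ k, 0 < ε k) :
    ∃ (R : Ω → ℕ) (h : Ω → ℝ), Measurable R ∧ Measurable h ∧ (∀ ω, h ω ∈ Set.Icc (0 : ℝ) 1) ∧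
      (∀ c, μ (h ⁻¹' {c}) = 0) ∧ (∀ k, (2⁻¹ : ℝ≥0∞) ^ (k + 1) ≤ μ {ω | k < R ω}) ∧
      ∀ k, μ {ω | ¬(R (T ω) = R ω ∧ h (T ω) = h ω) ∧ max (R ω) (R (T ω)) = k} ≤ ε k := by
  classical
  have hTm := hT.measurable
  -- A change at level `k` is caused by one visit to `B k` or by a visit to `B (k - 1)` at one of
  -- two times, hence the thirds of both `ε k` and `ε (k + 1)`. The last term makes the measures of
  -- the visit sets summable.
  have hδ : ∀ k, 0 < min (min (ε k / 3) (ε (k + 1) / 3)) ((2⁻¹ : ℝ≥0∞) ^ (k + 1)) := fun k =>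
    lt_min (lt_min (ENNReal.div_pos (hε _).ne' (by simp)) (ENNReal.div_pos (hε _).ne' (by simp)))
      (ENNReal.pow_pos (by simp) _)
  choose B hBm hB0 hBδ using fun k => hsmall _ (hδ k)
  have hB1 : ∀ k, μ (B k) ≤ ε k / 3 := fun k =>
    (hBδ k).trans ((min_le_left _ _).trans (min_le_left _ _))
  have hB2 : ∀ k, μ (B k) ≤ ε (k + 1) / 3 := fun k =>
    (hBδ k).trans ((min_le_left _ _).trans (min_le_right _ _))
  have hB3 : ∀ k, μ (B k) ≤ (2⁻¹ : ℝ≥0∞) ^ (k + 1) := fun k => (hBδ k).trans (min_le_right _ _)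
  choose n hn1 hn2 using fun k => exists_measure_visitSet hT (hBm k) (hB0 k)
    (a := (2⁻¹ : ℝ≥0∞) ^ (k + 1)) (pow_lt_one₀ zero_le (by simp) (by simp))
  set V : ℕ → Set Ω := fun k => visitSet T (B k) (n k) with hV
  have hVm : ∀ k, MeasurableSet (V k) := fun k => measurableSet_visitSet hTm (hBm k) _
  have hVsum : ∑' k, μ (V k) ≠ ∞ := by
    refine ne_top_of_le_ne_top (b := ∑' k : ℕ, (2 : ℝ≥0∞) * (2⁻¹ : ℝ≥0∞) ^ (k + 1)) ?_
      (ENNReal.tsum_le_tsum fun k => ((hn2 k).trans (add_le_add le_rfl (hB3 k))).trans (two_mul _).ge)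
    rw [ENNReal.tsum_mul_left]
    simp_rw [pow_succ]
    rw [ENNReal.tsum_mul_right, ENNReal.tsum_geometric]
    norm_num
    exact ENNReal.mul_ne_top (by simp) (ENNReal.mul_ne_top (by simp) (by simp))
  have hgood : ∀ᵐ ω ∂μ, ∃ k, ∀ j ≥ k, ω ∉ V j := by
    filter_upwards [ae_eventually_notMem hVsum] with ω hω
    exact eventually_atTop.1 hω
  have hp : ∀ ω, ∃ k, (∀ j ≥ k, ω ∉ V j) ∨ ¬∃ k, ∀ j ≥ k, ω ∉ V j := fun ω => by
    by_cases h : ∃ k, ∀ j ≥ k, ω ∉ V j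
    · exact h.imp fun k => Or.inl
    · exact ⟨0, Or.inr h⟩
  -- `R ω` is the first index from which on `ω` avoids all `V j`, and `0` on the null set where
  -- there is none. Thus `ω ∈ V k` forces `R ω > k` almost everywhere, and `R ω = k + 1` forces `ω ∈
  -- V k`.
  set R : Ω → ℕ := fun ω => Nat.find (hp ω) with hR
  have hRm : Measurable R := by
    refine measurable_find hp fun k => ?_
    have h1 : ∀ k, MeasurableSet {ω | ∀ j ≥ k, ω ∉ V j} := fun k => by
      have : {ω | ∀ j ≥ k, ω ∉ V j} = ⋂ j ≥ k, (V j)ᶜ := by ext; simp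
      rw [this]
      exact .biInter (Set.to_countable _) fun j _ => (hVm j).compl
    have : {ω | (∀ j ≥ k, ω ∉ V j) ∨ ¬∃ k, ∀ j ≥ k, ω ∉ V j}
        = {ω | ∀ j ≥ k, ω ∉ V j} ∪ (⋃ k, {ω | ∀ j ≥ k, ω ∉ V j})ᶜ := by ext; simp
    rw [this]
    exact (h1 k).union (MeasurableSet.iUnion h1).compl
  have hR1 : ∀ ω, (∃ k, ∀ j ≥ k, ω ∉ V j) → ∀ j, R ω ≤ j → ω ∉ V j := fun ω h j hj =>
    (Nat.find_spec (hp ω)).elim (fun h' => h' j hj) fun h' => absurd h h'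
  have hR2 : ∀ ω k, R ω = k + 1 → ω ∈ V k := fun ω k h => by
    have h1 := Nat.find_min (hp ω) (m := k) (by change k < R ω; omega)
    rw [not_or, not_not] at h1
    by_contra hk
    refine h1.1 fun j hj => ?_
    rcases hj.eq_or_lt with rfl | hj
    · exact hk
    · exact hR1 ω h1.2 j (by omega)
  -- The label at level `k` is `φ` at the first visit to `B k`, so it stays constant until the orbit
  -- leaves a point of `B k`.
  set H : ℕ → Ω → ℝ := fun k ω => φ (T^[firstVisit T (B k) ω] ω) with hH
  have hHm : ∀ k, Measurable (H k) := fun k => hφ.comp (measurable_iterate_firstVisit hTm (hBm k))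
  have hhm : Measurable fun ω => H (R ω) ω :=
    (measurable_from_prod_countable_right (f := fun p : ℕ × Ω => H p.1 p.2) hHm).comp
      (hRm.prodMk measurable_id)
  refine ⟨R, fun ω => H (R ω) ω, hRm, hhm, fun ω => hφ01 _, fun c => ?_, fun k => ?_, fun k => ?_⟩
  · refine measure_mono_null (t := ⋃ m, T^[m] ⁻¹' (φ ⁻¹' {c})) (fun ω hω => ?_)
      (measure_iUnion_null fun m => ?_)
    · exact Set.mem_iUnion.2 ⟨_, hω⟩
    · rw [(hT.toMeasurePreserving.iterate m).measure_preimage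
        (hφ (measurableSet_singleton c)).nullMeasurableSet, hφa]
  · refine (hn1 k).trans (measure_mono_ae ?_)
    filter_upwards [hgood] with ω hω hk
    exact not_le.1 fun h => hR1 ω hω k h hk
  -- If `R` does not change, the label does, and then `ω ∈ B k`. If `R` changes with maximum `k = m
  -- + 1`, exactly one of `ω`, `T ω` lies in `V m`, so `B m` is visited at time `0` or `n m`.
  · have hsub : ∀ᵐ ω ∂μ,
        ω ∈ {ω | ¬(R (T ω) = R ω ∧ H (R (T ω)) (T ω) = H (R ω) ω) ∧ max (R ω) (R (T ω)) = k} →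
        ω ∈ B k ∪ (B (k - 1) ∪ T^[n (k - 1)] ⁻¹' (B (k - 1))) ∩ {_ω | k ≠ 0} := by
      have hgT := hT.quasiMeasurePreserving.ae hgood
      filter_upwards [hgood, hgT, ae_exists_iterate_mem hT (hBm k) (hB0 k)] with ω h1 h2 h3 hω
      obtain ⟨hne, hmax⟩ := hω
      by_cases hRR : R (T ω) = R ω
      · have hk : R ω = k := by rw [hRR, max_self] at hmax; exact hmax
        left
        by_contra hB
        refine hne ⟨hRR, ?_⟩
        rw [hRR, hk]
        exact congrArg φ (iterate_firstVisit_map hB h3)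
      · right
        have hk0 : k ≠ 0 := by
          rintro rfl
          have := max_eq_bot.1 hmax
          exact hRR (this.2.trans this.1.symm)
        refine ⟨mem_or_iterate_mem_of_visitSet_ne fun hiff => ?_, hk0⟩
        obtain ⟨m, rfl⟩ := Nat.exists_eq_succ_of_ne_zero hk0
        rw [Nat.succ_sub_one] at hiff
        have e1 := hR1 ω h1 m
        have e2 := hR1 (T ω) h2 m
        have e3 := hR2 ω m
        have e4 := hR2 (T ω) m
        rcases max_cases (R ω) (R (T ω)) with h | h
        · exact e2 (by omega) (hiff.1 (e3 (by omega)))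
        · exact e1 (by omega) (hiff.2 (e4 (by omega)))
    refine (measure_mono_ae hsub).trans ?_
    by_cases hk : k = 0
    · subst hk
      refine (measure_mono (t := B 0) ?_).trans ((hB1 0).trans (ENNReal.div_le_of_le_mul ?_))
      · rintro ω (h | ⟨-, h⟩)
        · exact h
        · exact absurd rfl h
      · calc ε 0 = ε 0 * 1 := (mul_one _).symm
          _ ≤ ε 0 * 3 := by gcongr; norm_num
    · obtain ⟨m, rfl⟩ := Nat.exists_eq_succ_of_ne_zero hk
      rw [Nat.succ_sub_one]
      calc _ ≤ μ (B (m + 1)) + (μ (B m) + μ (T^[n m] ⁻¹' (B m))) :=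
            (measure_union_le _ _).trans (add_le_add le_rfl
              ((measure_mono Set.inter_subset_left).trans (measure_union_le _ _)))
        _ ≤ ε (m + 1) / 3 + (ε (m + 1) / 3 + ε (m + 1) / 3) := by
            rw [(hT.toMeasurePreserving.iterate _).measure_preimage (hBm m).nullMeasurableSet]
            exact add_le_add (hB1 _) (add_le_add (hB2 m) (hB2 m))
        _ = ε (m + 1) := by rw [← add_assoc, ENNReal.add_thirds]

end Visits

/-! ### Realising a law by monotone transport -/

section Transport

open ProbabilityTheory

/-- The cumulative distribution function of an atomless law is continuous. -/
theorem continuous_cdf_of_atomless (m : Measure ℝ) [IsProbabilityMeasure m] [NullSingletonClass m] :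
    Continuous (cdf m) := by
  refine continuous_iff_continuousAt.2 fun x => ?_
  refine continuousAt_iff_continuous_left'_right'.2 ⟨?_, ?_⟩
  · have h : (cdf m).measure {x} = 0 := by rw [measure_cdf]; exact measure_singleton x
    rw [StieltjesFunction.measure_singleton, ENNReal.ofReal_eq_zero, sub_nonpos] at h
    have h' : Function.leftLim (cdf m) x = cdf m x := le_antisymm ((monotone_cdf m).leftLim_le le_rfl) h
    rw [ContinuousWithinAt, ← h']
    exact (monotone_cdf m).tendsto_leftLim x
  · exact continuousWithinAt_Ioi_iff_Ici.2 ((cdf m).right_continuous x)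

/-- Under an atomless law, its cumulative distribution function is uniformly distributed. -/
theorem measure_cdf_le (m : Measure ℝ) [IsProbabilityMeasure m] [NullSingletonClass m] {c : ℝ}
    (h0 : 0 ≤ c) (h1 : c ≤ 1) : m {w | cdf m w ≤ c} = ENNReal.ofReal c := by
  have hcont := continuous_cdf_of_atomless m
  rcases h1.eq_or_lt with rfl | h1
  · have : {w | cdf m w ≤ 1} = Set.univ := Set.eq_univ_of_forall fun w => cdf_le_one m w
    rw [this]; simp
  -- The sublevel set is closed, so its supremum belongs to it and bounds its mass from above. A
  -- point where the continuous function `cdf m` equals `c` bounds it from below.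
  apply le_antisymm
  · rcases Set.eq_empty_or_nonempty {w | cdf m w ≤ c} with he | hne
    · rw [he]; simp
    · obtain ⟨b, hb⟩ := ((tendsto_cdf_atTop m).eventually (lt_mem_nhds h1)).exists
      have hbdd : BddAbove {w | cdf m w ≤ c} :=
        ⟨b, fun w hw => le_of_lt ((monotone_cdf m).reflect_lt (lt_of_le_of_lt hw hb))⟩
      have hcl : IsClosed {w | cdf m w ≤ c} := isClosed_le hcont continuous_const
      have hmem : cdf m (sSup {w | cdf m w ≤ c}) ≤ c := hcl.csSup_mem hne hbdd
      calc m {w | cdf m w ≤ c} ≤ m (Set.Iic (sSup {w | cdf m w ≤ c})) :=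
            measure_mono fun w hw => le_csSup hbdd hw
        _ = ENNReal.ofReal (cdf m (sSup {w | cdf m w ≤ c})) := (ofReal_cdf m _).symm
        _ ≤ ENNReal.ofReal c := ENNReal.ofReal_le_ofReal hmem
  · rcases h0.eq_or_lt with rfl | h0
    · simp
    · obtain ⟨a, ha⟩ := ((tendsto_cdf_atBot m).eventually (gt_mem_nhds h0)).exists
      obtain ⟨b, hb⟩ := ((tendsto_cdf_atTop m).eventually (lt_mem_nhds h1)).exists
      obtain ⟨t, ht⟩ := mem_range_of_exists_le_of_exists_ge hcont ⟨a, ha.le⟩ ⟨b, hb.le⟩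
      calc ENNReal.ofReal c = m (Set.Iic t) := by rw [← ofReal_cdf, ht]
        _ ≤ _ := measure_mono fun w hw => (monotone_cdf m hw).trans ht.le

/-- Existence of a quantile function. -/
theorem exists_quantile (ν : Measure ℝ) [IsProbabilityMeasure ν] :
    ∃ Q : ℝ → ℝ, Measurable Q ∧ ∀ u, 0 < u → u < 1 → ∀ z, Q u ≤ z ↔ u ≤ cdf ν z := by
  classical
  -- Right continuity of the distribution function makes the infimum belong to the set.
  have key : ∀ u, 0 < u → u < 1 → ∀ z, sInf {z | u ≤ cdf ν z} ≤ z ↔ u ≤ cdf ν z := by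
    intro u h0 h1 z
    obtain ⟨a, ha⟩ := ((tendsto_cdf_atBot ν).eventually (gt_mem_nhds h0)).exists
    obtain ⟨b, hb⟩ := ((tendsto_cdf_atTop ν).eventually (lt_mem_nhds h1)).exists
    have hbdd : BddBelow {z | u ≤ cdf ν z} :=
      ⟨a, fun w hw => le_of_lt ((monotone_cdf ν).reflect_lt (lt_of_lt_of_le ha hw))⟩
    have hne : {z | u ≤ cdf ν z}.Nonempty := ⟨b, hb.le⟩
    refine ⟨fun hz => ?_, fun hz => csInf_le hbdd hz⟩
    have hright : Tendsto (cdf ν) (𝓝[>] z) (𝓝 (cdf ν z)) :=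
      continuousWithinAt_Ioi_iff_Ici.2 ((cdf ν).right_continuous z)
    refine ge_of_tendsto hright ?_
    filter_upwards [self_mem_nhdsWithin] with y hy
    obtain ⟨w, hw, hwy⟩ := exists_lt_of_csInf_lt hne (lt_of_le_of_lt hz hy)
    exact le_trans hw (monotone_cdf ν hwy.le)
  refine ⟨fun u => if u ∈ Set.Ioo (0 : ℝ) 1 then sInf {z | u ≤ cdf ν z} else 0, ?_, ?_⟩
  · refine measurable_of_Iic fun z => ?_
    have : (fun u => if u ∈ Set.Ioo (0 : ℝ) 1 then sInf {z | u ≤ cdf ν z} else 0) ⁻¹' Set.Iic z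
        = (Set.Ioo 0 1 ∩ Set.Iic (cdf ν z)) ∪ ((Set.Ioo 0 1)ᶜ ∩ {_u | 0 ≤ z}) := by
      ext u
      by_cases hu : u ∈ Set.Ioo (0 : ℝ) 1
      · have := key u hu.1 hu.2 z
        simpa [hu.1, hu.2] using this
      · have hu' : ¬(0 < u ∧ u < 1) := hu
        simp [hu']
    rw [this]
    exact (measurableSet_Ioo.inter measurableSet_Iic).union
      (measurableSet_Ioo.compl.inter (MeasurableSet.const _))
  · intro u h0 h1 z
    simp only [if_pos (Set.mem_Ioo.2 ⟨h0, h1⟩)]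
    exact key u h0 h1 z

/-- The monotone transport from an atomless law on the line to another law on the line. -/
theorem exists_monotone_transport (m ν : Measure ℝ) [IsProbabilityMeasure m] [NullSingletonClass m]
    [IsProbabilityMeasure ν] :
    ∃ e : ℝ → ℝ, Measurable e ∧ m.map e = ν ∧ ∀ᵐ w ∂m, ∀ z, e w ≤ z ↔ cdf m w ≤ cdf ν z := by
  obtain ⟨Q, hQ, hQz⟩ := exists_quantile ν
  have hm : Measurable (cdf m) := (continuous_cdf_of_atomless m).measurable
  have h0 : ∀ᵐ w ∂m, 0 < cdf m w := by
    have := measure_cdf_le m le_rfl zero_le_one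
    rw [ENNReal.ofReal_zero] at this
    filter_upwards [measure_eq_zero_iff_ae_notMem.1 this] with w hw
    exact not_le.1 hw
  have h1 : ∀ᵐ w ∂m, cdf m w < 1 := by
    rw [ae_iff]
    refine le_antisymm (ENNReal.le_of_forall_pos_le_add fun δ hδ _ => ?_) zero_le
    rcases le_or_gt 1 δ with h | h
    · exact prob_le_one.trans (by simpa using h)
    have hδ1 : (δ : ℝ) < 1 := by exact_mod_cast h
    have hδ0 : (0 : ℝ) < δ := by exact_mod_cast hδ
    have hms : MeasurableSet {w | cdf m w ≤ 1 - δ} := measurableSet_le hm measurable_const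
    calc m {w | ¬cdf m w < 1} ≤ m {w | cdf m w ≤ 1 - δ}ᶜ :=
          measure_mono fun w hw hw' => hw (lt_of_le_of_lt hw' (by linarith))
      _ = 1 - ENNReal.ofReal (1 - δ) := by
          rw [prob_compl_eq_one_sub hms, measure_cdf_le m (by linarith) (by linarith)]
      _ = ENNReal.ofReal δ := by
          rw [← ENNReal.ofReal_one, ← ENNReal.ofReal_sub _ (by linarith)]; congr 1; ring
      _ ≤ 0 + δ := by simp
  have hae : ∀ᵐ w ∂m, ∀ z, Q (cdf m w) ≤ z ↔ cdf m w ≤ cdf ν z := by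
    filter_upwards [h0, h1] with w h0 h1
    exact hQz _ h0 h1
  have hQm : Measurable fun w => Q (cdf m w) := hQ.comp hm
  refine ⟨fun w => Q (cdf m w), hQm, ?_, hae⟩
  have : IsProbabilityMeasure (m.map fun w => Q (cdf m w)) :=
    Measure.isProbabilityMeasure_map hQm.aemeasurable
  refine Measure.ext_of_Iic _ _ fun z => ?_
  rw [Measure.map_apply hQm measurableSet_Iic, ← ofReal_cdf,
    ← measure_cdf_le m (cdf_nonneg ν z) (cdf_le_one ν z)]
  refine measure_congr (eventuallyEq_set.2 ?_)
  filter_upwards [hae] with w hw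
  exact hw z

/-- If the atomless function `R + h` is so large that `R` exceeds `k` at least as often as `ν`
charges the complement of `K k`, then a law `ν` can be realised as the law of a function of `R + h`
which lies in `K (R + 1)`. -/
theorem exists_realization {Ω Θ : Type*} [MeasurableSpace Ω] {μ : Measure Ω}
    [IsProbabilityMeasure μ] [MeasurableSpace Θ] [StandardBorelSpace Θ] (ν : Measure Θ)
    [IsProbabilityMeasure ν] {K : ℕ → Set Θ} (hKm : ∀ k, MeasurableSet (K k)) (hK : Monotone K)
    (hKν : ∀ᵐ x ∂ν, ∃ k, x ∈ K k) {R : Ω → ℕ} {h : Ω → ℝ} (hR : Measurable R) (hh : Measurable h)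
    (hh01 : ∀ ω, h ω ∈ Set.Icc (0 : ℝ) 1) (hha : ∀ c, μ (h ⁻¹' {c}) = 0)
    (hRK : ∀ k, ν (K k)ᶜ ≤ μ {ω | k < R ω}) :
    ∃ e : ℝ → Θ, Measurable e ∧ μ.map (fun ω => e (R ω + h ω)) = ν ∧
      ∀ᵐ ω ∂μ, e (R ω + h ω) ∈ K (R ω + 1) := by
  classical
  obtain ⟨x₀⟩ : Nonempty Θ := nonempty_of_isProbabilityMeasure ν
  have hp : ∀ x, ∃ k, x ∈ K k ∨ ∀ k, x ∉ K k := fun x => by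
    by_cases hx : ∃ k, x ∈ K k
    · exact hx.imp fun k => Or.inl
    · exact ⟨0, Or.inr (not_exists.1 hx)⟩
  set lev : Θ → ℕ := fun x => Nat.find (hp x) with hlev
  have hlevm : Measurable lev := by
    refine measurable_find hp fun k => ?_
    have : {x | x ∈ K k ∨ ∀ k, x ∉ K k} = K k ∪ ⋂ k, (K k)ᶜ := by ext; simp
    rw [this]
    exact (hKm k).union (.iInter fun k => (hKm k).compl)
  set ψ : Θ → ℝ := fun x => (unitInterval.sigmoid (embeddingReal Θ x) : ℝ) with hψ
  have hψe : MeasurableEmbedding ψ :=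
    (MeasurableEmbedding.subtype_coe measurableSet_Icc).comp
      (measurableEmbedding_sigmoid_comp_embeddingReal Θ)
  have hψ01 : ∀ x, 0 ≤ ψ x ∧ ψ x ≤ 1 := fun x => (unitInterval.sigmoid (embeddingReal Θ x)).2
  -- Halving keeps the second term below `1`, so `ρ x` determines `lev x` and then `ψ x`.
  set ρ : Θ → ℝ := fun x => lev x + ψ x / 2 with hρ
  have hρm : Measurable ρ :=
    ((measurable_from_nat (f := fun n : ℕ => (n : ℝ))).comp hlevm).add (hψe.measurable.div_const 2)
  have hρi : Function.Injective ρ := by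
    intro x y hxy
    have hx := hψ01 x
    have hy := hψ01 y
    simp only [hρ] at hxy
    have h1 : (lev x : ℝ) < lev y + 1 := by linarith
    have h2 : (lev y : ℝ) < lev x + 1 := by linarith
    norm_cast at h1 h2
    have h3 : lev x = lev y := by omega
    rw [h3] at hxy
    exact hψe.injective (by linarith)
  have hρe : MeasurableEmbedding ρ := hρm.measurableEmbedding hρi
  set w : Ω → ℝ := fun ω => R ω + h ω with hw
  have hwm : Measurable w := ((measurable_from_nat (f := fun n : ℕ => (n : ℝ))).comp hR).add hh
  have hwa : ∀ c, μ (w ⁻¹' {c}) = 0 := fun c => by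
    refine measure_mono_null (t := ⋃ k : ℕ, h ⁻¹' {c - k}) (fun ω hω => ?_)
      (measure_iUnion_null fun k => hha _)
    refine Set.mem_iUnion.2 ⟨R ω, ?_⟩
    have : (R ω : ℝ) + h ω = c := hω
    simp [← this]
  set m := μ.map w with hm
  have : IsProbabilityMeasure m := Measure.isProbabilityMeasure_map hwm.aemeasurable
  have : NullSingletonClass m := ⟨fun c => by
    rw [hm, Measure.map_apply hwm (measurableSet_singleton c)]; exact hwa c⟩
  have : IsProbabilityMeasure (ν.map ρ) := Measure.isProbabilityMeasure_map hρm.aemeasurable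
  obtain ⟨q, hqm, hqmap, hqz⟩ := exists_monotone_transport m (ν.map ρ)
  have : Nonempty Θ := ⟨x₀⟩
  have hinv : Measurable hρe.invFun := hρe.measurable_invFun
  have hmap : μ.map (fun ω => hρe.invFun (q (w ω))) = ν := by
    have h1 : μ.map (fun ω => hρe.invFun (q (w ω))) = ((μ.map w).map q).map hρe.invFun := by
      rw [Measure.map_map hqm hwm, Measure.map_map hinv (hqm.comp hwm)]; rfl
    rw [h1, ← hm, hqmap, Measure.map_map hinv hρm, hρe.leftInverse_invFun.id, Measure.map_id]
  refine ⟨fun t => hρe.invFun (q t), hinv.comp hqm, hmap, ?_⟩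
  have hgood : ∀ᵐ ω ∂μ, ∃ k, hρe.invFun (q (w ω)) ∈ K k := by
    have hmm : Measurable fun ω => hρe.invFun (q (w ω)) := hinv.comp (hqm.comp hwm)
    rw [← hmap] at hKν
    exact ae_of_ae_map hmm.aemeasurable hKν
  have hrange : ∀ᵐ ω ∂μ, q (w ω) ∈ Set.range ρ := by
    have h1 : ∀ᵐ z ∂(m.map q), z ∈ Set.range ρ := by
      rw [hqmap]
      exact (ae_map_iff hρm.aemeasurable hρe.measurableSet_range).2 (.of_forall fun x => ⟨x, rfl⟩)
    exact ae_of_ae_map hwm.aemeasurable (ae_of_ae_map hqm.aemeasurable h1)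
  filter_upwards [hgood, hrange, ae_of_ae_map hwm.aemeasurable hqz] with ω hg ⟨x, hx⟩ hz
  have hxe : hρe.invFun (q (w ω)) = x := by rw [← hx]; exact hρe.leftInverse_invFun x
  change hρe.invFun (q (w ω)) ∈ _
  rw [hxe] at hg ⊢
  -- By monotone transport it suffices that the law of `w` gives `(-∞, k + 1]` no more mass than the
  -- law of `ρ` does, where `k = R ω`. Up to a null set `w ≤ k + 1` forces `R ≤ k`, while `ρ ≤ k +
  -- 1` on `K k`; the hypothesis `hRK` compares the two.
  have hle : q (w ω) ≤ (R ω : ℝ) + 1 := by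
    rw [hz]
    have hwle : w ω ≤ (R ω : ℝ) + 1 := by simpa [hw] using (hh01 ω).2
    refine (monotone_cdf m hwle).trans ?_
    rw [cdf_eq_real, cdf_eq_real, measureReal_def, measureReal_def]
    refine ENNReal.toReal_mono (measure_ne_top _ _) ?_
    set k := R ω
    have hRm : MeasurableSet {ω | k < R ω} := measurableSet_lt measurable_const hR
    calc m (Set.Iic ((k : ℝ) + 1)) = μ (w ⁻¹' Set.Iic ((k : ℝ) + 1)) :=
          Measure.map_apply hwm measurableSet_Iic
      _ ≤ μ ({ω | k < R ω}ᶜ ∪ w ⁻¹' {(k : ℝ) + 1}) := by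
          refine measure_mono fun ω' hω' => ?_
          by_contra hc
          rw [Set.mem_union, not_or, Set.mem_compl_iff, not_not] at hc
          have h1 : ((k + 1 : ℕ) : ℝ) ≤ R ω' := by exact_mod_cast hc.1
          have h2 : (R ω' : ℝ) + h ω' ≤ k + 1 := hω'
          have h3 := (hh01 ω').1
          push_cast at h1
          exact hc.2 (le_antisymm h2 (by change _ ≤ (R ω' : ℝ) + h ω'; linarith))
      _ ≤ μ {ω | k < R ω}ᶜ := by
          refine (measure_union_le _ _).trans ?_
          rw [hwa, add_zero]
      _ = 1 - μ {ω | k < R ω} := prob_compl_eq_one_sub hRm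
      _ ≤ 1 - ν (K k)ᶜ := tsub_le_tsub_left (hRK k) 1
      _ = ν (K k) := by
          rw [← prob_compl_eq_one_sub (hKm k).compl, compl_compl]
      _ ≤ ν (ρ ⁻¹' Set.Iic ((k : ℝ) + 1)) := by
          refine measure_mono fun y hy => ?_
          have h1 : lev y ≤ k := Nat.find_min' (hp y) (Or.inl hy)
          have h2 : (lev y : ℝ) ≤ k := by exact_mod_cast h1
          have := hψ01 y
          change (lev y : ℝ) + ψ y / 2 ≤ k + 1
          linarith
      _ = (ν.map ρ) (Set.Iic ((k : ℝ) + 1)) := (Measure.map_apply hρm measurableSet_Iic).symm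
  have hlx : lev x ≤ R ω + 1 := by
    have h1 : (lev x : ℝ) + ψ x / 2 ≤ (R ω : ℝ) + 1 := by rw [← hx] at hle; exact hle
    have := hψ01 x
    have h2 : (lev x : ℝ) ≤ (R ω : ℝ) + 1 := by linarith
    exact_mod_cast h2
  exact hK hlx ((Nat.find_spec (hp x)).elim id fun h' => absurd hg (not_exists.2 h'))

end Transport

/-! ### Matrices between pairs of lines -/

/-- Pairs of angles that determine distinct lines. -/
abbrev AnglePair : Type := {q : ℝ × ℝ // Real.sin (q.2 - q.1) ≠ 0}

theorem isOpen_setOf_sin_sub_ne_zero : IsOpen {q : ℝ × ℝ | Real.sin (q.2 - q.1) ≠ 0} :=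
  isOpen_ne_fun (by fun_prop) continuous_const

instance AnglePair.instStandardBorelSpace : StandardBorelSpace AnglePair :=
  isOpen_setOf_sin_sub_ne_zero.measurableSet.standardBorel

/-- The sine of the angle between the two lines of a pair. -/
noncomputable def AnglePair.sine (q : AnglePair) : ℝ := Real.sin (q.1.2 - q.1.1)

theorem AnglePair.abs_sine_pos (q : AnglePair) : 0 < |q.sine| := abs_pos.2 q.2

theorem AnglePair.continuous_sine : Continuous AnglePair.sine := by
  unfold AnglePair.sine
  fun_prop

/-- The unit vector of angle `θ`. -/
noncomputable def unitVec (θ : ℝ) : Plane := !₂[Real.cos θ, Real.sin θ]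

theorem norm_unitVec (θ : ℝ) : ‖unitVec θ‖ = 1 := by
  simp [unitVec, EuclideanSpace.norm_eq, Fin.sum_univ_two]

theorem unitVec_ne_zero (θ : ℝ) : unitVec θ ≠ 0 := by
  rw [← norm_ne_zero_iff, norm_unitVec]; exact one_ne_zero

theorem continuous_unitVec : Continuous unitVec := by
  unfold unitVec
  refine (PiLp.continuous_toLp 2 _).comp (continuous_pi fun i => ?_)
  fin_cases i
  · exact Real.continuous_cos
  · exact Real.continuous_sin

/-- The invertible matrix whose columns are the unit vectors of the given angles. -/
noncomputable def frame (q : AnglePair) : GL (Fin 2) ℝ where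
  val := !![Real.cos q.1.1, Real.cos q.1.2; Real.sin q.1.1, Real.sin q.1.2]
  inv := q.sine⁻¹ • !![Real.sin q.1.2, -Real.cos q.1.2; -Real.sin q.1.1, Real.cos q.1.1]
  val_inv := by
    have h : q.sine ≠ 0 := q.2
    rw [Matrix.mul_smul, inv_smul_eq_iff₀ h]
    ext i j
    fin_cases i <;> fin_cases j <;> simp [AnglePair.sine, Real.sin_sub, Matrix.mul_apply] <;> ring
  inv_val := by
    have h : q.sine ≠ 0 := q.2
    rw [Matrix.smul_mul, inv_smul_eq_iff₀ h]
    ext i j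
    fin_cases i <;> fin_cases j <;> simp [AnglePair.sine, Real.sin_sub, Matrix.mul_apply] <;> ring

theorem continuous_frame : Continuous frame := by
  refine Units.continuous_iff.2 ⟨?_, ?_⟩
  · refine continuous_matrix fun i j => ?_
    fin_cases i <;> fin_cases j <;> simp [frame] <;> fun_prop
  · have h : Continuous fun q : AnglePair => q.sine⁻¹ :=
      AnglePair.continuous_sine.inv₀ fun q => q.2
    refine h.smul (continuous_matrix fun i j => ?_)
    fin_cases i <;> fin_cases j <;> simp <;> fun_prop

/-- The diagonal matrix with entries `exp s` and `exp t`. -/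
noncomputable def expDiag (s t : ℝ) : GL (Fin 2) ℝ where
  val := !![Real.exp s, 0; 0, Real.exp t]
  inv := !![Real.exp (-s), 0; 0, Real.exp (-t)]
  val_inv := by
    ext i j
    fin_cases i <;> fin_cases j <;> simp [Matrix.mul_apply, ← Real.exp_add]
  inv_val := by
    ext i j
    fin_cases i <;> fin_cases j <;> simp [Matrix.mul_apply, ← Real.exp_add]

theorem expDiag_mul (s t s' t' : ℝ) : expDiag s t * expDiag s' t' = expDiag (s + s') (t + t') := by
  ext i j
  fin_cases i <;> fin_cases j <;> simp [expDiag, Matrix.mul_apply, Real.exp_add]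

theorem expDiag_zero : expDiag 0 0 = 1 := by
  ext i j
  fin_cases i <;> fin_cases j <;> simp [expDiag]

theorem expDiag_inv (s t : ℝ) : (expDiag s t)⁻¹ = expDiag (-s) (-t) := by
  rw [inv_eq_iff_mul_eq_one, expDiag_mul, add_neg_cancel, add_neg_cancel, expDiag_zero]

/-- The matrix that maps the lines of `x` to the lines of `y`, with expansion rates `s` and `t`. -/
noncomputable def transition (x y : AnglePair) (s t : ℝ) : GL (Fin 2) ℝ :=
  frame y * expDiag s t * (frame x)⁻¹

/-- The frames of the intermediate pair cancel; this is what makes the cocycle telescope. -/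
theorem transition_mul (x y z : AnglePair) (s t s' t' : ℝ) :
    transition y z s' t' * transition x y s t = transition x z (s + s') (t + t') := by
  rw [add_comm s, add_comm t, transition, transition, transition, ← expDiag_mul]
  group

theorem transition_inv (x y : AnglePair) (s t : ℝ) :
    (transition x y s t)⁻¹ = transition y x (-s) (-t) := by
  rw [transition, transition, ← expDiag_inv]
  group

theorem transition_self_zero (x : AnglePair) : transition x x 0 0 = 1 := by
  rw [transition, expDiag_zero, mul_one, mul_inv_cancel]

theorem continuous_expDiag : Continuous fun p : ℝ × ℝ => expDiag p.1 p.2 := by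
  refine Units.continuous_iff.2 ⟨continuous_matrix fun i j => ?_, continuous_matrix fun i j => ?_⟩ <;>
    fin_cases i <;> fin_cases j <;> simp [expDiag] <;> fun_prop

theorem continuous_transition : Continuous fun p : (AnglePair × AnglePair) × ℝ × ℝ =>
    transition p.1.1 p.1.2 p.2.1 p.2.2 :=
  ((continuous_frame.comp (continuous_snd.comp continuous_fst)).mul
    (continuous_expDiag.comp continuous_snd)).mul
    (continuous_frame.comp (continuous_fst.comp continuous_fst)).inv

theorem glAct_mul (g g' : GL (Fin 2) ℝ) (v : Plane) : glAct (g * g') v = glAct g (glAct g' v) := by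
  simp [glAct]

theorem glAct_apply (g : GL (Fin 2) ℝ) (v : Plane) (i : Fin 2) :
    glAct g v i = g i 0 * v 0 + g i 1 * v 1 := by
  rw [glAct, Matrix.ofLp_toEuclideanCLM, Matrix.mulVec, dotProduct, Fin.sum_univ_two]

theorem glAct_frame_fst (q : AnglePair) : glAct (frame q) !₂[1, 0] = unitVec q.1.1 := by
  ext i
  fin_cases i <;> simp [glAct_apply, frame, unitVec]

theorem glAct_frame_snd (q : AnglePair) : glAct (frame q) !₂[0, 1] = unitVec q.1.2 := by
  ext i
  fin_cases i <;> simp [glAct_apply, frame, unitVec]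

theorem glAct_transition_fst (x y : AnglePair) (s t : ℝ) :
    glAct (transition x y s t) (unitVec x.1.1) = Real.exp s • unitVec y.1.1 := by
  have h : glAct (expDiag s t) !₂[1, 0] = Real.exp s • (!₂[1, 0] : Plane) := by
    ext i
    fin_cases i <;> simp [glAct_apply, expDiag]
  rw [← glAct_frame_fst, ← glAct_mul, transition, inv_mul_cancel_right, glAct_mul, h, map_smul,
    glAct_frame_fst]

theorem glAct_transition_snd (x y : AnglePair) (s t : ℝ) :
    glAct (transition x y s t) (unitVec x.1.2) = Real.exp t • unitVec y.1.2 := by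
  have h : glAct (expDiag s t) !₂[0, 1] = Real.exp t • (!₂[0, 1] : Plane) := by
    ext i
    fin_cases i <;> simp [glAct_apply, expDiag]
  rw [← glAct_frame_snd, ← glAct_mul, transition, inv_mul_cancel_right, glAct_mul, h, map_smul,
    glAct_frame_snd]

/-- Coordinates with respect to the lines of `x`. -/
theorem exists_coordinates (x : AnglePair) (v : Plane) :
    ∃ a b : ℝ, v = a • unitVec x.1.1 + b • unitVec x.1.2 ∧
      |a| ≤ ‖v‖ / |x.sine| ∧ |b| ≤ ‖v‖ / |x.sine| := by
  have hS : x.sine ≠ 0 := x.2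
  have hSe : x.sine = Real.sin x.1.2 * Real.cos x.1.1 - Real.cos x.1.2 * Real.sin x.1.1 :=
    Real.sin_sub _ _
  have hnorm : ∀ θ, |v 0 * Real.sin θ - v 1 * Real.cos θ| ≤ ‖v‖ := fun θ => by
    refine abs_le_of_sq_le_sq ?_ (norm_nonneg v)
    rw [EuclideanSpace.norm_sq_eq, Fin.sum_univ_two, Real.norm_eq_abs, Real.norm_eq_abs, sq_abs,
      sq_abs]
    nlinarith [sq_nonneg (v 0 * Real.cos θ + v 1 * Real.sin θ), Real.sin_sq_add_cos_sq θ]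
  refine ⟨(v 0 * Real.sin x.1.2 - v 1 * Real.cos x.1.2) / x.sine,
    -(v 0 * Real.sin x.1.1 - v 1 * Real.cos x.1.1) / x.sine, ?_, ?_, ?_⟩
  · ext i
    fin_cases i <;> simp [unitVec] <;> field_simp <;> rw [hSe] <;> ring
  · rw [abs_div]; gcongr; exact hnorm _
  · rw [abs_div, abs_neg]; gcongr; exact hnorm _

theorem glAct_transition_apply (x y : AnglePair) (s t a b : ℝ) :
    glAct (transition x y s t) (a • unitVec x.1.1 + b • unitVec x.1.2)
      = (a * Real.exp s) • unitVec y.1.1 + (b * Real.exp t) • unitVec y.1.2 := by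
  rw [map_add, map_smul, map_smul, glAct_transition_fst, glAct_transition_snd, smul_smul, smul_smul]

/-- The unit vectors of `x` are sent to vectors of length `exp s` and `exp t`, so no angle enters
the lower bound. -/
theorem max_le_log_glNorm_transition (x y : AnglePair) (s t : ℝ) :
    max s t ≤ Real.log (glNorm (transition x y s t)) := by
  have h1 : Real.exp s ≤ glNorm (transition x y s t) := by
    have := (glAct (transition x y s t)).le_opNorm (unitVec x.1.1)
    rwa [glAct_transition_fst, norm_smul, norm_unitVec, norm_unitVec, mul_one, mul_one,
      Real.norm_of_nonneg (Real.exp_pos s).le] at this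
  have h2 : Real.exp t ≤ glNorm (transition x y s t) := by
    have := (glAct (transition x y s t)).le_opNorm (unitVec x.1.2)
    rwa [glAct_transition_snd, norm_smul, norm_unitVec, norm_unitVec, mul_one, mul_one,
      Real.norm_of_nonneg (Real.exp_pos t).le] at this
  have h0 := (Real.exp_pos s).trans_le h1
  exact max_le ((Real.le_log_iff_exp_le h0).2 h1) ((Real.le_log_iff_exp_le h0).2 h2)

/-- The coordinates of `v` along the lines of `x` are at most `‖v‖ / |x.sine|`. Only the source pair
costs anything, since the vectors of the target frame have norm one. -/
theorem log_glNorm_transition_le (x y : AnglePair) (s t : ℝ) :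
    Real.log (glNorm (transition x y s t)) ≤ max s t + Real.log 2 + -Real.log |x.sine| := by
  have hS := x.abs_sine_pos
  have h : glNorm (transition x y s t) ≤ 2 * Real.exp (max s t) / |x.sine| := by
    refine ContinuousLinearMap.opNorm_le_bound _ (by positivity) fun v => ?_
    obtain ⟨a, b, hv, ha, hb⟩ := exists_coordinates x v
    have hs : Real.exp s ≤ Real.exp (max s t) := Real.exp_le_exp.2 (le_max_left _ _)
    have ht : Real.exp t ≤ Real.exp (max s t) := Real.exp_le_exp.2 (le_max_right _ _)
    calc ‖glAct (transition x y s t) v‖ ≤ |a| * Real.exp s + |b| * Real.exp t := by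
          conv_lhs => rw [hv, glAct_transition_apply]
          refine (norm_add_le _ _).trans (le_of_eq ?_)
          simp [norm_smul, norm_unitVec]
      _ ≤ ‖v‖ / |x.sine| * Real.exp (max s t) + ‖v‖ / |x.sine| * Real.exp (max s t) := by gcongr
      _ = _ := by ring
  have h0 : 0 < glNorm (transition x y s t) := by
    have := (glAct (transition x y s t)).le_opNorm (unitVec x.1.1)
    rw [glAct_transition_fst, norm_smul, norm_unitVec, norm_unitVec, mul_one, mul_one,
      Real.norm_of_nonneg (Real.exp_pos s).le] at this
    exact (Real.exp_pos s).trans_le this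
  refine (Real.log_le_log h0 h).trans (le_of_eq ?_)
  rw [Real.log_div (by positivity) hS.ne', Real.log_mul (by norm_num) (Real.exp_pos _).ne',
    Real.log_exp]
  ring

/-! ### Lines, angles and compact sets of angle pairs -/

/-- The pair of lines with given angles. -/
noncomputable def AnglePair.lines (q : AnglePair) : LinePairs :=
  ⟨(Projectivization.mk ℝ (unitVec q.1.1) (unitVec_ne_zero _),
    Projectivization.mk ℝ (unitVec q.1.2) (unitVec_ne_zero _)), fun h => by
    obtain ⟨a, ha⟩ := (Projectivization.mk_eq_mk_iff' ℝ _ _ _ _).1 h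
    have h0 : a * Real.cos q.1.2 = Real.cos q.1.1 := by
      simpa [unitVec] using congrArg (fun v : Plane => v 0) ha
    have h1 : a * Real.sin q.1.2 = Real.sin q.1.1 := by
      simpa [unitVec] using congrArg (fun v : Plane => v 1) ha
    refine q.2 ?_
    rw [Real.sin_sub, ← h0, ← h1]
    ring⟩

theorem AnglePair.fst_lines (q : AnglePair) : q.lines.fst = Submodule.span ℝ {unitVec q.1.1} :=
  Projectivization.submodule_mk _ _

theorem AnglePair.snd_lines (q : AnglePair) : q.lines.snd = Submodule.span ℝ {unitVec q.1.2} :=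
  Projectivization.submodule_mk _ _

theorem continuous_mk_unitVec :
    Continuous fun θ : ℝ => (Projectivization.mk ℝ (unitVec θ) (unitVec_ne_zero θ) : RP1) := by
  have h : Continuous (Projectivization.mk' ℝ : {v : Plane // v ≠ 0} → RP1) :=
    continuous_coinduced_rng
  exact h.comp (continuous_unitVec.subtype_mk unitVec_ne_zero)

theorem AnglePair.continuous_lines : Continuous AnglePair.lines := by
  refine Continuous.subtype_mk ?_ _
  exact (continuous_mk_unitVec.comp (by fun_prop : Continuous fun q : AnglePair => q.1.1)).prodMk
    (continuous_mk_unitVec.comp (by fun_prop : Continuous fun q : AnglePair => q.1.2))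

/-- The square of the complex coordinate of a line, normalised to have modulus one. -/
noncomputable def lineSquare (L : RP1) : ℂ :=
  Projectivization.lift (fun v : {v : Plane // v ≠ 0} =>
    ((v.1 0 : ℂ) + (v.1 1 : ℂ) * Complex.I) ^ 2 / ((‖v.1‖ ^ 2 : ℝ) : ℂ)) (by
      rintro ⟨v, hv⟩ ⟨w, hw⟩ a (h : v = a • w)
      subst h
      have ha : a ≠ 0 := by rintro rfl; simp at hv
      have ha' : (a : ℂ) ≠ 0 := by exact_mod_cast ha
      have hw' : ((‖w‖ : ℝ) : ℂ) ≠ 0 := by exact_mod_cast norm_ne_zero_iff.2 hw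
      simp only [norm_smul, mul_pow, Real.norm_eq_abs, sq_abs, PiLp.smul_apply, smul_eq_mul]
      push_cast
      field_simp) L

theorem continuous_lineSquare : Continuous lineSquare := by
  refine continuous_coinduced_dom.2 ?_
  change Continuous fun v : {v : Plane // v ≠ 0} =>
    ((v.1 0 : ℂ) + (v.1 1 : ℂ) * Complex.I) ^ 2 / ((‖v.1‖ ^ 2 : ℝ) : ℂ)
  refine Continuous.div (by fun_prop) (by fun_prop) fun v => ?_
  have : ‖v.1‖ ≠ 0 := norm_ne_zero_iff.2 v.2
  exact_mod_cast pow_ne_zero 2 this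

/-- An angle of a line, in `(-π/2, π/2]`. -/
noncomputable def lineAngle (L : RP1) : ℝ := (lineSquare L).arg / 2

theorem abs_lineAngle_le (L : RP1) : |lineAngle L| ≤ 2 := by
  have h := Complex.abs_arg_le_pi (lineSquare L)
  rw [lineAngle, abs_div, abs_two]
  linarith [Real.pi_le_four]

/-- Squaring removes the sign ambiguity of a direction vector; half the argument of the square
recovers the direction up to sign. -/
theorem mk_unitVec_lineAngle (L : RP1) :
    Projectivization.mk ℝ (unitVec (lineAngle L)) (unitVec_ne_zero _) = L := by
  induction L using Projectivization.ind with
  | h v hv =>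
    set z : ℂ := (v 0 : ℂ) + (v 1 : ℂ) * Complex.I with hz
    have hn : 0 < ‖v‖ := norm_pos_iff.2 hv
    have hsq : lineSquare (Projectivization.mk ℝ v hv) = z ^ 2 / ((‖v‖ ^ 2 : ℝ) : ℂ) := rfl
    set θ := lineAngle (Projectivization.mk ℝ v hv) with hθ
    have hznorm : ‖z‖ = ‖v‖ := by
      rw [hz, Complex.norm_add_mul_I, EuclideanSpace.norm_eq, Fin.sum_univ_two]
      simp
    have h1 : ‖lineSquare (Projectivization.mk ℝ v hv)‖ = 1 := by
      rw [hsq, norm_div, norm_pow, hznorm, Complex.norm_real, Real.norm_of_nonneg (by positivity)]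
      exact div_self (by positivity)
    have h2 : lineSquare (Projectivization.mk ℝ v hv) = Complex.exp (θ * Complex.I) ^ 2 := by
      conv_lhs => rw [← Complex.norm_mul_exp_arg_mul_I (lineSquare (Projectivization.mk ℝ v hv)),
        h1]
      rw [← Complex.exp_nat_mul, hθ, lineAngle]
      push_cast
      rw [one_mul]
      congr 1
      ring
    have h3 : z ^ 2 = (‖v‖ * Complex.exp (θ * Complex.I)) ^ 2 := by
      rw [mul_pow, ← h2, hsq]
      have : ((‖v‖ : ℝ) : ℂ) ≠ 0 := by exact_mod_cast hn.ne'
      push_cast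
      field_simp
    have hre : ∀ c : ℝ, (c * Complex.exp (θ * Complex.I)).re = c * Real.cos θ := fun c => by
      rw [Complex.re_ofReal_mul, Complex.exp_ofReal_mul_I_re]
    have him : ∀ c : ℝ, (c * Complex.exp (θ * Complex.I)).im = c * Real.sin θ := fun c => by
      rw [Complex.im_ofReal_mul, Complex.exp_ofReal_mul_I_im]
    have hzre : z.re = v 0 := by simp [hz]
    have hzim : z.im = v 1 := by simp [hz]
    have h4 : ∃ c : ℝ, z = c * Complex.exp (θ * Complex.I) ∧ c ≠ 0 := by
      rcases sq_eq_sq_iff_eq_or_eq_neg.1 h3 with h | h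
      · exact ⟨‖v‖, h, hn.ne'⟩
      · exact ⟨-‖v‖, by rw [h]; push_cast; ring, neg_ne_zero.2 hn.ne'⟩
    obtain ⟨c, hc, hc0⟩ := h4
    symm
    refine (Projectivization.mk_eq_mk_iff' ℝ _ _ _ _).2 ⟨c, ?_⟩
    ext i
    fin_cases i
    · exact (hre c).symm.trans ((congrArg Complex.re hc).symm.trans hzre)
    · exact (him c).symm.trans ((congrArg Complex.im hc).symm.trans hzim)

/-- A choice of angles for a pair of lines. -/
noncomputable def LinePairs.angles (p : LinePairs) : AnglePair :=
  ⟨(lineAngle p.1.1, lineAngle p.1.2), fun h => by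
    refine p.2 ?_
    rw [← mk_unitVec_lineAngle p.1.1, ← mk_unitVec_lineAngle p.1.2]
    obtain ⟨n, hn⟩ := Real.sin_eq_zero_iff.1 h
    have hn : lineAngle p.1.2 = lineAngle p.1.1 + n * Real.pi := by
      change n * Real.pi = lineAngle p.1.2 - lineAngle p.1.1 at hn
      linarith
    symm
    refine (Projectivization.mk_eq_mk_iff' ℝ _ _ _ _).2 ⟨(-1) ^ n, ?_⟩
    ext i
    fin_cases i
    · simp [unitVec, hn, Real.cos_add_int_mul_pi]
    · simp [unitVec, hn, Real.sin_add_int_mul_pi]⟩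

theorem LinePairs.lines_angles (p : LinePairs) : p.angles.lines = p :=
  Subtype.ext (Prod.ext (mk_unitVec_lineAngle _) (mk_unitVec_lineAngle _))

theorem LinePairs.measurable_angles : Measurable LinePairs.angles := by
  have h1 : Continuous fun p : LinePairs => lineSquare p.1.1 :=
    continuous_lineSquare.comp (continuous_fst.comp continuous_subtype_val)
  have h2 : Continuous fun p : LinePairs => lineSquare p.1.2 :=
    continuous_lineSquare.comp (continuous_snd.comp continuous_subtype_val)
  exact (((Complex.measurable_arg.comp h1.measurable).div_const 2).prodMk
    ((Complex.measurable_arg.comp h2.measurable).div_const 2)).subtype_mk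

/-- An exhaustion of the bounded pairs of angles by compact sets. -/
def angleCompact (k : ℕ) : Set AnglePair :=
  {q | |q.1.1| ≤ 2 ∧ |q.1.2| ≤ 2 ∧ 1 / ((k : ℝ) + 1) ≤ |q.sine|}

theorem isCompact_angleCompact (k : ℕ) : IsCompact (angleCompact k) := by
  rw [Subtype.isCompact_iff]
  have : Subtype.val '' angleCompact k =
      (Set.Icc (-2 : ℝ) 2 ×ˢ Set.Icc (-2 : ℝ) 2) ∩
        {q : ℝ × ℝ | 1 / ((k : ℝ) + 1) ≤ |Real.sin (q.2 - q.1)|} := by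
    ext q
    constructor
    · rintro ⟨x, ⟨h1, h2, h3⟩, rfl⟩
      exact ⟨⟨abs_le.1 h1, abs_le.1 h2⟩, h3⟩
    · rintro ⟨⟨h1, h2⟩, h3⟩
      have h3 : 1 / ((k : ℝ) + 1) ≤ |Real.sin (q.2 - q.1)| := h3
      have h0 : (0 : ℝ) < 1 / ((k : ℝ) + 1) := Nat.one_div_pos_of_nat
      exact ⟨⟨q, abs_pos.1 (h0.trans_le h3)⟩, ⟨abs_le.2 h1, abs_le.2 h2, h3⟩, rfl⟩
  rw [this]
  exact (isCompact_Icc.prod isCompact_Icc).inter_right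
    (isClosed_le continuous_const (by fun_prop))

theorem monotone_angleCompact : Monotone angleCompact := by
  rintro j k hjk q ⟨h1, h2, h3⟩
  exact ⟨h1, h2, (Nat.one_div_le_one_div hjk).trans h3⟩

theorem exists_angles_mem_angleCompact (p : LinePairs) : ∃ k, p.angles ∈ angleCompact k := by
  obtain ⟨k, hk⟩ := exists_nat_one_div_lt p.angles.abs_sine_pos
  exact ⟨k, abs_lineAngle_le _, abs_lineAngle_le _, hk.le⟩

/-- A locally bounded function is bounded on compact sets. -/
theorem IsLocallyBounded.exists_bound {X : Type*} [TopologicalSpace X] {N : X → ℝ}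
    (hN : IsLocallyBounded N) {s : Set X} (hs : IsCompact s) : ∃ C, ∀ x ∈ s, N x ≤ C := by
  refine hs.induction_on (p := fun s => ∃ C, ∀ x ∈ s, N x ≤ C) ⟨0, by simp⟩ ?_ ?_ ?_
  · rintro s t hst ⟨C, hC⟩
    exact ⟨C, fun x hx => hC x (hst hx)⟩
  · rintro s t ⟨C, hC⟩ ⟨D, hD⟩
    refine ⟨max C D, fun x hx => hx.elim (fun h => (hC x h).trans (le_max_left _ _))
      fun h => (hD x h).trans (le_max_right _ _)⟩
  · intro x _
    obtain ⟨U, hU, C, hC⟩ := hN x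
    exact ⟨U, mem_nhdsWithin_of_mem_nhds hU, C, fun y hy => (le_abs_self _).trans (hC y hy)⟩

theorem exists_bound_transition {N : GL (Fin 2) ℝ → ℝ} (hN : IsLocallyBounded N) (s t : ℝ)
    (k : ℕ) : ∃ C, ∀ x ∈ angleCompact k, ∀ y ∈ angleCompact k, N (transition x y s t) ≤ C := by
  have hcomp := ((isCompact_angleCompact k).prod (isCompact_angleCompact k)).prod
    (isCompact_singleton (x := (s, t)))
  obtain ⟨C, hC⟩ := hN.exists_bound (hcomp.image continuous_transition)
  exact ⟨C, fun x hx y hy => hC _ ⟨((x, y), (s, t)), ⟨⟨hx, hy⟩, rfl⟩, rfl⟩⟩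

/-! ### Growth rates and Oseledets spaces -/

/-- With `Q < c < d < P`, the inequality gives `|a| ≤ (1 + |b|) exp (-(d - c) m)` eventually, and
the right side tends to `0`. -/
theorem eq_zero_of_exp_growth {ι : Type*} {l : Filter ι} [l.NeBot] {m p q t : ι → ℝ}
    {P Q a b : ℝ} (hm : Tendsto m l atTop) (hp : Tendsto (fun i => p i / m i) l (𝓝 P))
    (hq : Tendsto (fun i => q i / m i) l (𝓝 Q)) (ht : Tendsto (fun i => t i / m i) l (𝓝 Q))
    (hQP : Q < P) (h : ∀ i, |a| * Real.exp (p i) ≤ Real.exp (t i) + |b| * Real.exp (q i)) :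
    a = 0 := by
  obtain ⟨c, hQc, hcP⟩ := exists_between hQP
  obtain ⟨d, hcd, hdP⟩ := exists_between hcP
  have hlim : Tendsto (fun i => (1 + |b|) * Real.exp (-((d - c) * m i))) l (𝓝 0) := by
    have := (Real.tendsto_exp_neg_atTop_nhds_zero.comp
      (hm.const_mul_atTop (sub_pos.2 hcd))).const_mul (1 + |b|)
    simpa using this
  refine abs_eq_zero.1 (le_antisymm (ge_of_tendsto hlim ?_) (abs_nonneg a))
  filter_upwards [hm.eventually_gt_atTop 0, hp.eventually (lt_mem_nhds hdP),
    hq.eventually (gt_mem_nhds hQc), ht.eventually (gt_mem_nhds hQc)] with i h0 h1 h2 h3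
  rw [lt_div_iff₀ h0] at h1
  rw [div_lt_iff₀ h0] at h2 h3
  have h4 : |a| * Real.exp (d * m i) ≤ (1 + |b|) * Real.exp (c * m i) := by
    calc |a| * Real.exp (d * m i) ≤ |a| * Real.exp (p i) := by gcongr
      _ ≤ Real.exp (t i) + |b| * Real.exp (q i) := h i
      _ ≤ Real.exp (c * m i) + |b| * Real.exp (c * m i) := by gcongr
      _ = _ := by ring
  have h5 : Real.exp (-((d - c) * m i)) = Real.exp (c * m i) / Real.exp (d * m i) := by
    rw [← Real.exp_sub]; congr 1; ring
  rw [h5, ← mul_div_assoc, le_div_iff₀ (Real.exp_pos _)]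
  exact h4

theorem tendsto_const_div_intCast (c : ℝ) :
    Tendsto (fun n : ℤ => c / (n : ℝ)) (atBot ⊔ atTop) (𝓝 0) := by
  have h1 : Tendsto (fun n : ℤ => (n : ℝ)⁻¹) atTop (𝓝 0) :=
    tendsto_inv_atTop_zero.comp tendsto_intCast_atTop_atTop
  have h2 : Tendsto (fun n : ℤ => (n : ℝ)⁻¹) atBot (𝓝 0) :=
    tendsto_inv_atBot_zero.comp (tendsto_intCast_atBot_iff.2 tendsto_id)
  simpa [div_eq_mul_inv] using (h2.sup h1).const_mul c

section Oseledets

variable {Ω : Type*} [MeasurableSpace Ω] {T : Ω ≃ᵐ Ω} {F : Ω → GL (Fin 2) ℝ} {ω : Ω}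
  {x₀ : AnglePair} {x : ℤ → AnglePair} {s t : ℤ → ℝ} {r₁ r₂ : ℝ}

theorem mem_oseledetsSpace_of_growth {u : ℤ → Plane} {r : ℝ} {s : ℤ → ℝ} (hu : ∀ n, ‖u n‖ = 1)
    {e : Plane} (hF : ∀ n, glAct (cocycle T F n ω) e = Real.exp (s n) • u n)
    (hs : Tendsto (fun n : ℤ => s n / n) (atBot ⊔ atTop) (𝓝 r)) (a : ℝ) :
    a • e ∈ oseledetsSpace T F r ω := by
  rcases eq_or_ne a 0 with rfl | ha
  · exact Or.inl (zero_smul _ _)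
  · refine Or.inr ?_
    have h := (tendsto_const_div_intCast (Real.log |a|)).add hs
    rw [zero_add] at h
    refine h.congr fun n => ?_
    rw [map_smul, hF, norm_smul, norm_smul, hu, mul_one, Real.norm_eq_abs, Real.norm_eq_abs,
      Real.abs_exp, Real.log_mul (abs_ne_zero.2 ha) (Real.exp_pos _).ne', Real.log_exp]
    ring

/-- The triangle inequality bounds each component by the whole image and the other component,
whatever the angle of the image lines. -/
theorem exp_growth_le_of_cocycle_eq (hF : ∀ n, cocycle T F n ω = transition x₀ (x n) (s n) (t n))
    {a b : ℝ} (hv : a • unitVec x₀.1.1 + b • unitVec x₀.1.2 ≠ 0) (n : ℤ) :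
    |a| * Real.exp (s n) ≤ Real.exp (Real.log
        ‖glAct (cocycle T F n ω) (a • unitVec x₀.1.1 + b • unitVec x₀.1.2)‖)
        + |b| * Real.exp (t n) ∧
    |b| * Real.exp (t n) ≤ Real.exp (Real.log
        ‖glAct (cocycle T F n ω) (a • unitVec x₀.1.1 + b • unitVec x₀.1.2)‖)
        + |a| * Real.exp (s n) := by
  have hne : glAct (cocycle T F n ω) (a • unitVec x₀.1.1 + b • unitVec x₀.1.2) ≠ 0 := fun h0 => by
    refine hv ?_
    have := congrArg (glAct (cocycle T F n ω)⁻¹) h0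
    rw [← glAct_mul, inv_mul_cancel, map_zero] at this
    simpa [glAct] using this
  rw [Real.exp_log (norm_pos_iff.2 hne), hF, glAct_transition_apply]
  set p := (a * Real.exp (s n)) • unitVec (x n).1.1 with hp
  set q := (b * Real.exp (t n)) • unitVec (x n).1.2 with hq
  have hpn : ‖p‖ = |a| * Real.exp (s n) := by simp [hp, norm_smul, norm_unitVec]
  have hqn : ‖q‖ = |b| * Real.exp (t n) := by simp [hq, norm_smul, norm_unitVec]
  rw [← hpn, ← hqn]
  constructor
  · simpa using norm_sub_le (p + q) q
  · simpa using norm_sub_le (p + q) p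

/-- Backward time excludes a second component at rate `r₁`: as `n → -∞` it would grow at rate `-r₂ >
-r₁` in `-n`. Forward time excludes a first component at rate `r₂`. -/
theorem oseledetsSpace_eq_span (hr : r₂ < r₁)
    (hF : ∀ n, cocycle T F n ω = transition x₀ (x n) (s n) (t n))
    (hs : Tendsto (fun n : ℤ => s n / n) (atBot ⊔ atTop) (𝓝 r₁))
    (ht : Tendsto (fun n : ℤ => t n / n) (atBot ⊔ atTop) (𝓝 r₂)) :
    oseledetsSpace T F r₁ ω = (x₀.lines.fst : Set Plane) ∧
      oseledetsSpace T F r₂ ω = (x₀.lines.snd : Set Plane) := by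
  rw [AnglePair.fst_lines, AnglePair.snd_lines]
  constructor
  · refine Set.Subset.antisymm ?_ ?_
    · intro v hv
      obtain ⟨a, b, rfl, -, -⟩ := exists_coordinates x₀ v
      rcases hv with hv | hv
      · rw [hv]; exact Submodule.zero_mem _
      by_cases h0 : a • unitVec x₀.1.1 + b • unitVec x₀.1.2 = 0
      · rw [h0]; exact Submodule.zero_mem _
      have hb : b = 0 := by
        refine eq_zero_of_exp_growth (l := atBot) (m := fun n : ℤ => -(n : ℝ)) (P := -r₂) (Q := -r₁)
          (tendsto_neg_atBot_atTop.comp (tendsto_intCast_atBot_iff.2 tendsto_id))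
          ?_ ?_ ?_ (neg_lt_neg hr) fun n => (exp_growth_le_of_cocycle_eq hF h0 n).2
        · simpa [div_neg] using (ht.mono_left le_sup_left).neg
        · simpa [div_neg] using (hs.mono_left le_sup_left).neg
        · refine ((hv.mono_left le_sup_left).neg).congr fun n => ?_
          rw [div_neg]; ring
      rw [hb, zero_smul, add_zero]
      exact Submodule.smul_mem _ _ (Submodule.mem_span_singleton_self _)
    · intro v hv
      obtain ⟨a, rfl⟩ := Submodule.mem_span_singleton.1 hv
      exact mem_oseledetsSpace_of_growth (fun n => norm_unitVec (x n).1.1)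
        (fun n => by rw [hF, glAct_transition_fst]) hs a
  · refine Set.Subset.antisymm ?_ ?_
    · intro v hv
      obtain ⟨a, b, rfl, -, -⟩ := exists_coordinates x₀ v
      rcases hv with hv | hv
      · rw [hv]; exact Submodule.zero_mem _
      by_cases h0 : a • unitVec x₀.1.1 + b • unitVec x₀.1.2 = 0
      · rw [h0]; exact Submodule.zero_mem _
      have ha : a = 0 := by
        refine eq_zero_of_exp_growth (l := atTop) (m := fun n : ℤ => (n : ℝ)) (P := r₁) (Q := r₂)
          tendsto_intCast_atTop_atTop (hs.mono_left le_sup_right) (ht.mono_left le_sup_right)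
          ?_ hr fun n => (exp_growth_le_of_cocycle_eq hF h0 n).1
        refine (hv.mono_left le_sup_right).congr fun n => ?_
        ring
      rw [ha, zero_smul, zero_add]
      exact Submodule.smul_mem _ _ (Submodule.mem_span_singleton_self _)
    · intro v hv
      obtain ⟨a, rfl⟩ := Submodule.mem_span_singleton.1 hv
      exact mem_oseledetsSpace_of_growth (fun n => norm_unitVec (x n).1.2)
        (fun n => by rw [hF, glAct_transition_snd]) ht a

theorem tendsto_log_glNorm_transition {x y : ℕ → AnglePair} {s t : ℕ → ℝ} {r₁ r₂ : ℝ}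
    (hs : Tendsto (fun n : ℕ => s n / n) atTop (𝓝 r₁))
    (ht : Tendsto (fun n : ℕ => t n / n) atTop (𝓝 r₂))
    (hx : Tendsto (fun n : ℕ => -Real.log |(x n).sine| / n) atTop (𝓝 0)) :
    Tendsto (fun n : ℕ => (1 / (n : ℝ)) * Real.log (glNorm (transition (x n) (y n) (s n) (t n))))
      atTop (𝓝 (max r₁ r₂)) := by
  have hmax := hs.max ht
  have hmax' : ∀ n : ℕ, max (s n / n) (t n / n) = max (s n) (t n) / n := fun n =>
    (max_div_div_right (Nat.cast_nonneg n) _ _)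
  have hup := (hmax.add (tendsto_const_div_atTop_nhds_zero_nat (Real.log 2))).add hx
  rw [add_zero, add_zero] at hup
  refine tendsto_of_tendsto_of_tendsto_of_le_of_le hmax hup (fun n => ?_) (fun n => ?_)
  · change max (s n / n) (t n / n) ≤ _
    rw [hmax', one_div_mul_eq_div]
    exact div_le_div_of_nonneg_right (max_le_log_glNorm_transition _ _ _ _) (Nat.cast_nonneg n)
  · change _ ≤ max (s n / n) (t n / n) + _ + _
    rw [hmax', one_div_mul_eq_div, ← add_div, ← add_div]
    exact div_le_div_of_nonneg_right (log_glNorm_transition_le _ _ _ _) (Nat.cast_nonneg n)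

end Oseledets

/-! ### The cocycle generated by a field of line pairs -/

section Generated

variable {Ω : Type*} [MeasurableSpace Ω]

/-- The cocycle generator that maps the lines of `x ω` to the lines of `x (T ω)` with expansion
rates `a * χ ω` and `b * χ ω`. -/
noncomputable def generator (T : Ω ≃ᵐ Ω) (x : Ω → AnglePair) (χ : Ω → ℝ) (a b : ℝ) (ω : Ω) :
    GL (Fin 2) ℝ :=
  transition (x ω) (x (T ω)) (a * χ ω) (b * χ ω)

/-- The Birkhoff sum of `χ` at an integer time. -/
noncomputable def intBirkhoffSum (T : Ω ≃ᵐ Ω) (χ : Ω → ℝ) (ω : Ω) : ℤ → ℝ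
  | Int.ofNat n => birkhoffSum T χ n ω
  | Int.negSucc n => -birkhoffSum T.symm χ (n + 1) (T.symm ω)

/-- The point of the orbit of `ω` at an integer time. -/
def orbitPoint (T : Ω ≃ᵐ Ω) (ω : Ω) : ℤ → Ω
  | Int.ofNat n => T^[n] ω
  | Int.negSucc n => T.symm^[n + 1] ω

variable {T : Ω ≃ᵐ Ω} {x : Ω → AnglePair} {χ : Ω → ℝ} {a b : ℝ}

theorem measurable_generator (hx : Measurable x) (hχ : Measurable χ) :
    Measurable (generator T x χ a b) := by
  have h1 : Measurable fun p : (AnglePair × AnglePair) × ℝ × ℝ =>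
      transition p.1.1 p.1.2 p.2.1 p.2.2 := continuous_transition.measurable
  have h2 : Measurable fun ω => ((x ω, x (T ω)), a * χ ω, b * χ ω) :=
    (hx.prodMk (hx.comp T.measurable)).prodMk ((hχ.const_mul a).prodMk (hχ.const_mul b))
  have h3 := h1.comp h2
  simp only [Function.comp_def] at h3
  exact h3

theorem cocycleNat_generator (n : ℕ) (ω : Ω) :
    cocycleNat T (generator T x χ a b) n ω =
      transition (x ω) (x (T^[n] ω)) (a * birkhoffSum T χ n ω) (b * birkhoffSum T χ n ω) := by
  induction n with
  | zero => rw [birkhoffSum_zero, mul_zero, mul_zero]; exact (transition_self_zero _).symm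
  | succ n ih =>
    rw [cocycleNat, ih, generator, transition_mul, birkhoffSum_succ, ← mul_add, ← mul_add,
      Function.iterate_succ_apply']

theorem birkhoffSum_symm_iterate (n : ℕ) (ω : Ω) :
    birkhoffSum T χ n (T.symm^[n] ω) = birkhoffSum T.symm χ n (T.symm ω) := by
  induction n with
  | zero => simp
  | succ n ih =>
    rw [birkhoffSum_succ', birkhoffSum_succ, Function.iterate_succ_apply', T.apply_symm_apply, ih,
      ← Function.iterate_succ_apply, Function.iterate_succ_apply', add_comm]

theorem cocycle_generator (n : ℤ) (ω : Ω) :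
    cocycle T (generator T x χ a b) n ω = transition (x ω) (x (orbitPoint T ω n))
      (a * intBirkhoffSum T χ ω n) (b * intBirkhoffSum T χ ω n) := by
  cases n with
  | ofNat n => exact cocycleNat_generator n ω
  | negSucc n =>
    have h : Function.LeftInverse T T.symm := T.apply_symm_apply
    rw [cocycle, cocycleNat_generator, transition_inv, birkhoffSum_symm_iterate, h.iterate (n + 1),
      intBirkhoffSum, orbitPoint, mul_neg, mul_neg]

theorem ae_tendsto_intBirkhoffSum_div {μ : Measure Ω} [IsProbabilityMeasure μ] (hT : Ergodic T μ)
    (hχ : Measurable χ) {C : ℝ} (hC : ∀ ω, |χ ω| ≤ C) :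
    ∀ᵐ ω ∂μ, Tendsto (fun n : ℤ => intBirkhoffSum T χ ω n / n) (atBot ⊔ atTop)
      (𝓝 (∫ ω, χ ω ∂μ)) := by
  have hS : Ergodic T.symm μ := hT.symm
  -- At negative times the sum runs over `T⁻¹ ω, T⁻² ω, …`, so the ergodic theorem for `T.symm` is
  -- applied at `T.symm ω`.
  filter_upwards [ae_tendsto_birkhoffSum_div hT hχ hC,
    hS.quasiMeasurePreserving.ae (ae_tendsto_birkhoffSum_div hS hχ hC)] with ω h1 h2
  refine Tendsto.sup ?_ ?_
  · have h3 : Tendsto (fun n : ℤ => intBirkhoffSum T χ ω (-n) / ((-n : ℤ) : ℝ)) atTop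
        (𝓝 (∫ ω, χ ω ∂μ)) := by
      rw [← Nat.map_cast_int_atTop, tendsto_map'_iff, ← tendsto_add_atTop_iff_nat 1]
      refine ((tendsto_add_atTop_iff_nat 1).2 h2).congr fun n => ?_
      have : -((n + 1 : ℕ) : ℤ) = Int.negSucc n := rfl
      simp only [Function.comp_apply]
      rw [this, intBirkhoffSum, ← this]
      push_cast
      rw [neg_div_neg_eq]
    simpa [Function.comp_def] using h3.comp tendsto_neg_atBot_atTop
  · rw [← Nat.map_cast_int_atTop, tendsto_map'_iff]
    exact h1.congr fun n => by simp [intBirkhoffSum]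

end Generated

/-! ### Sublinearity, integrability and exhaustion -/

/-- A sequence whose records are sublinear is sublinear. -/
theorem tendsto_div_zero_of_le_max {f g : ℕ → ℝ} (hf : ∀ n, 0 ≤ f n)
    (hfg : ∀ n, f (n + 1) ≤ max (f n) (g n)) (hg : ∀ c : ℝ, 0 < c → ∀ᶠ n : ℕ in atTop, g n ≤ c * n) :
    Tendsto (fun n : ℕ => f n / n) atTop (𝓝 0) := by
  rw [tendsto_order]
  refine ⟨fun a ha => .of_forall fun n => ha.trans_le (div_nonneg (hf n) (Nat.cast_nonneg n)),
    fun a ha => ?_⟩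
  obtain ⟨m, hm⟩ := eventually_atTop.1 (hg (a / 2) (half_pos ha))
  -- After time `m` the sequence `f` can only rise to a value of `g`, which is at most `a / 2 * n`.
  have hind : ∀ n ≥ m, f n ≤ max (f m) (a / 2 * n) := by
    intro n hn
    induction n, hn using Nat.le_induction with
    | base => exact le_max_left _ _
    | succ n hn ih =>
      refine (hfg n).trans (max_le (ih.trans (max_le_max le_rfl ?_))
        ((hm n hn).trans (le_trans ?_ (le_max_right _ _)))) <;>
      · push_cast; nlinarith
  have hlim : Tendsto (fun n : ℕ => f m / n) atTop (𝓝 0) := tendsto_const_div_atTop_nhds_zero_nat _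
  filter_upwards [hlim.eventually (gt_mem_nhds ha), eventually_ge_atTop m, eventually_gt_atTop 0]
    with n h1 h2 h3
  have h0 : (0 : ℝ) < n := by exact_mod_cast h3
  rw [div_lt_iff₀ h0] at h1 ⊢
  refine (hind n h2).trans_lt (max_lt h1 ?_)
  nlinarith [mul_pos ha h0]

theorem upperIntegral_lt_top_of_ae_le {Ω : Type*} [MeasurableSpace Ω] {μ : Measure Ω}
    {f g : Ω → ℝ≥0∞} (hg : Measurable g) (hgi : ∫⁻ ω, g ω ∂μ < ∞) (hfg : ∀ᵐ ω ∂μ, f ω ≤ g ω) :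
    upperIntegral μ f < ∞ := by
  classical
  set s := toMeasurable μ {ω | ¬f ω ≤ g ω} with hs
  have hsm : MeasurableSet s := measurableSet_toMeasurable _ _
  have hs0 : μ s = 0 := by rw [hs, measure_toMeasurable]; exact hfg
  -- Setting the majorant to `∞` on a measurable null set makes the domination hold everywhere.
  refine lt_of_le_of_lt (iInf_le_of_le (s.piecewise (fun _ => ∞) g) (iInf_le_of_le
    (Measurable.piecewise hsm measurable_const hg) (iInf_le _ fun ω => ?_))) ?_
  · by_cases h : ω ∈ s
    · simp [h]
    · simp only [h, not_false_eq_true, Set.piecewise_eq_of_notMem]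
      by_contra hc
      exact h (subset_toMeasurable _ _ hc)
  · refine lt_of_eq_of_lt (lintegral_congr_ae ?_) hgi
    filter_upwards [measure_eq_zero_iff_ae_notMem.1 hs0] with ω hω
    simp [hω]

/-- On a non-atomic Lebesgue space there are an atomless function and sets of small positive
measure. -/
theorem IsNonatomicLebesgueSpace.exists_atomless {Ω : Type*} [MeasurableSpace Ω] {μ : Measure Ω}
    (hΩ : IsNonatomicLebesgueSpace μ) :
    ∃ φ : Ω → ℝ, Measurable φ ∧ (∀ ω, φ ω ∈ Set.Icc (0 : ℝ) 1) ∧ (∀ c, μ (φ ⁻¹' {c}) = 0) ∧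
      ∀ δ : ℝ≥0∞, 0 < δ → ∃ B, MeasurableSet B ∧ 0 < μ B ∧ μ B ≤ δ := by
  obtain ⟨φ, -, hφ, -, hvol, -⟩ := hΩ
  have hφa : AEMeasurable φ μ := hφ.aemeasurable
  set Φ := hφa.mk φ with hΦ
  have hΦm : Measurable Φ := hφa.measurable_mk
  have hΦvol : ∀ s, MeasurableSet s → μ (Φ ⁻¹' s) = volume s := fun s hs => by
    rw [← hvol s hs]
    refine measure_congr (eventuallyEq_set.2 ?_)
    filter_upwards [hφa.ae_eq_mk] with ω hω
    simp [hΦ, hω]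
  refine ⟨fun ω => Φ ω, measurable_subtype_coe.comp hΦm, fun ω => (Φ ω).2, fun c => ?_,
    fun δ hδ => ?_⟩
  · by_cases hc : c ∈ unitInterval
    · refine measure_mono_null (t := Φ ⁻¹' {⟨c, hc⟩}) (fun ω hω => ?_) ?_
      · have hω : (Φ ω : ℝ) = c := hω
        exact Subtype.ext hω
      · rw [hΦvol _ (measurableSet_singleton _), measure_singleton]
    · refine measure_mono_null (t := ∅) (fun ω hω => hc ?_) measure_empty
      have hω : (Φ ω : ℝ) = c := hω
      exact hω ▸ (Φ ω).2
  · have hd : min δ 1 ≠ ∞ := ne_top_of_le_ne_top ENNReal.one_ne_top (min_le_right _ _)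
    have hd1 : (min δ 1).toReal ≤ 1 := ENNReal.toReal_le_of_le_ofReal zero_le_one (by simp)
    refine ⟨Φ ⁻¹' Set.Iic ⟨(min δ 1).toReal, ENNReal.toReal_nonneg, hd1⟩, hΦm measurableSet_Iic, ?_⟩
    rw [hΦvol _ measurableSet_Iic, unitInterval.volume_Iic, ENNReal.ofReal_toReal hd]
    exact ⟨lt_min hδ zero_lt_one, min_le_left _ _⟩

/-- The bound `2⁻¹ ^ (k + 1)` is the lower bound for the probability of `k < R` in
`exists_rarely_changing`, as `exists_realization` requires. -/
theorem exists_exhaustion (ν : Measure AnglePair) [IsProbabilityMeasure ν]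
    (hν : ∀ᵐ q ∂ν, ∃ k, q ∈ angleCompact k) :
    ∃ κ : ℕ → ℕ, StrictMono κ ∧ ∀ k, ν (angleCompact (κ k))ᶜ ≤ (2⁻¹ : ℝ≥0∞) ^ (k + 1) := by
  have hm : ∀ k, MeasurableSet (angleCompact k) := fun k => (isCompact_angleCompact k).measurableSet
  refine extraction_forall_of_eventually (P := fun k j => ν (angleCompact j)ᶜ ≤ _) fun k => ?_
  have h0 : ν (⋂ j, (angleCompact j)ᶜ) = 0 := by
    refine measure_eq_zero_iff_ae_notMem.2 ?_
    filter_upwards [hν] with q ⟨j, hj⟩ hq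
    exact Set.mem_iInter.1 hq j hj
  have h := tendsto_measure_iInter_atTop (μ := ν) (s := fun j => (angleCompact j)ᶜ)
    (fun j => (hm j).compl.nullMeasurableSet)
    (fun i j hij => Set.compl_subset_compl.2 (monotone_angleCompact hij)) ⟨0, measure_ne_top _ _⟩
  rw [h0] at h
  filter_upwards [h.eventually (gt_mem_nhds (ENNReal.pow_pos (by simp : (0 : ℝ≥0∞) < 2⁻¹) (k + 1)))]
    with j hj
  exact hj.le

theorem neg_log_abs_sine_nonneg (q : AnglePair) : 0 ≤ -Real.log |q.sine| :=
  neg_nonneg.2 (Real.log_nonpos (abs_nonneg _) (Real.abs_sin_le_one _))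

theorem neg_log_abs_sine_le {k : ℕ} {q : AnglePair} (hq : q ∈ angleCompact k) :
    -Real.log |q.sine| ≤ Real.log ((k : ℝ) + 1) := by
  have h0 : (0 : ℝ) < 1 / ((k : ℝ) + 1) := Nat.one_div_pos_of_nat
  have h := Real.log_le_log h0 hq.2.2
  rw [one_div, Real.log_inv] at h
  linarith

theorem lintegral_ofReal_indicator_lt_top {Ω : Type*} [MeasurableSpace Ω] {μ : Measure Ω}
    {S : Set Ω} {m : Ω → ℕ} (hS : MeasurableSet S) (hm : Measurable m) {c : ℕ → ℝ}
    (hS2 : ∀ k, μ {ω | ω ∈ S ∧ m ω = k} ≤ (2⁻¹ : ℝ≥0∞) ^ k / (ENNReal.ofReal (c k) + 1)) :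
    ∫⁻ ω, ENNReal.ofReal (S.indicator (fun ω => c (m ω)) ω) ∂μ < ∞ := by
  have hSk : ∀ k, MeasurableSet {ω | ω ∈ S ∧ m ω = k} := fun k =>
    hS.inter (hm (measurableSet_singleton k))
  calc ∫⁻ ω, ENNReal.ofReal (S.indicator (fun ω => c (m ω)) ω) ∂μ
      ≤ ∫⁻ ω, ∑' k, {ω | ω ∈ S ∧ m ω = k}.indicator (fun _ => ENNReal.ofReal (c k)) ω ∂μ := by
        refine lintegral_mono fun ω => ?_
        by_cases h : ω ∈ S
        · refine le_trans (le_of_eq ?_) (ENNReal.le_tsum (m ω))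
          rw [Set.indicator_of_mem h, Set.indicator_of_mem]
          exact ⟨h, rfl⟩
        · simp [h]
    _ = ∑' k, ENNReal.ofReal (c k) * μ {ω | ω ∈ S ∧ m ω = k} := by
        rw [lintegral_tsum fun k => (measurable_const.indicator (hSk k)).aemeasurable]
        simp [lintegral_indicator, hSk]
    _ ≤ ∑' k : ℕ, (2⁻¹ : ℝ≥0∞) ^ k := by
        refine ENNReal.tsum_le_tsum fun k => ?_
        calc ENNReal.ofReal (c k) * μ {ω | ω ∈ S ∧ m ω = k}
            ≤ (ENNReal.ofReal (c k) + 1) * ((2⁻¹ : ℝ≥0∞) ^ k / (ENNReal.ofReal (c k) + 1)) :=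
              mul_le_mul' le_self_add (hS2 k)
          _ = (2⁻¹ : ℝ≥0∞) ^ k := ENNReal.mul_div_cancel (by simp) (by simp)
    _ < ∞ := by
        rw [ENNReal.tsum_geometric]
        norm_num

/-! ### Construction of the cocycle -/

/-- `N` is not assumed measurable, so the finiteness of the integral of `N ∘ F` is stated for the
upper integral. Note that `N ≥ 0`, since `max ‖g‖ ‖g⁻¹‖ ≥ 1`. -/
theorem theorem1p3 {Ω : Type*} [MeasurableSpace Ω] (μ : Measure Ω) [IsProbabilityMeasure μ]
    (hΩ : IsNonatomicLebesgueSpace μ)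
    (T : Ω ≃ᵐ Ω) (hT : Ergodic T μ)
    (N : GL (Fin 2) ℝ → ℝ) (hN : IsLocallyBounded N)
    (hNlog : ∀ g : GL (Fin 2) ℝ, Real.log (max (glNorm g) (glNorm (g⁻¹))) ≤ N g)
    (r₁ r₂ : ℝ) (hr : r₂ < r₁)
    (η : Measure LinePairs) [IsProbabilityMeasure η] :
    ∃ F : Ω → GL (Fin 2) ℝ, Measurable F ∧
      upperIntegral μ (fun ω => ENNReal.ofReal (N (F ω))) < ∞ ∧
      HasLyapunovExponents μ T F r₁ r₂ ∧
      OseledetsJointDistribution μ T F r₁ r₂ η := by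
  classical
  obtain ⟨φ, hφ, hφ01, hφa, hsmall⟩ := hΩ.exists_atomless
  set ν : Measure AnglePair := η.map LinePairs.angles with hν
  have hνp : IsProbabilityMeasure ν :=
    Measure.isProbabilityMeasure_map LinePairs.measurable_angles.aemeasurable
  have hcm : ∀ k, MeasurableSet (angleCompact k) := fun k => (isCompact_angleCompact k).measurableSet
  have hνc : ∀ᵐ q ∂ν, ∃ k, q ∈ angleCompact k := by
    refine (ae_map_iff LinePairs.measurable_angles.aemeasurable ?_).2
      (.of_forall exists_angles_mem_angleCompact)
    have : {q | ∃ k, q ∈ angleCompact k} = ⋃ k, angleCompact k := by ext; simp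
    rw [this]
    exact .iUnion hcm
  obtain ⟨κ, hκ, hκν⟩ := exists_exhaustion ν hνc
  set L : ℕ → Set AnglePair := fun k => angleCompact (κ k) with hL
  have hLm : ∀ k, MeasurableSet (L k) := fun k => hcm _
  have hLmono : Monotone L := fun i j hij => monotone_angleCompact (hκ.monotone hij)
  have hLν : ∀ᵐ q ∂ν, ∃ k, q ∈ L k := by
    filter_upwards [hνc] with q ⟨k, hk⟩
    exact ⟨k, monotone_angleCompact (hκ.id_le k) hk⟩
  set p : ℝ := ν.real (L 0) with hp
  -- The complement of `L 0` has mass at most `1 / 2`.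
  have hp0 : 0 < p := by
    refine ENNReal.toReal_pos (fun h0 => ?_) (measure_ne_top _ _)
    have h1 := hκν 0
    rw [prob_compl_eq_one_sub (hLm 0), h0] at h1
    norm_num at h1
  obtain ⟨M, hM⟩ := exists_bound_transition hN (r₁ / p) (r₂ / p) (κ 0)
  choose C₁ hC₁ using fun k => exists_bound_transition hN (r₁ / p) (r₂ / p) (κ (k + 1))
  choose C₀ hC₀ using fun k => exists_bound_transition hN 0 0 (κ (k + 1))
  -- `c k` bounds `N ∘ F`, with or without stretching, and minus the logarithm of the sine, for
  -- pairs in `L (k + 1)`. The shift is there because `x ω` is only known to lie in `L (R ω + 1)`.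
  -- Since `c` does not depend on `R` and `h`, these can be chosen afterwards.
  set c : ℕ → ℝ := fun k =>
    max 0 (max (C₁ k) (max (C₀ k) (Real.log ((κ (k + 1) : ℝ) + 1)))) with hc
  obtain ⟨R, h, hR, hh, hh01, hha, hRμ, hRh⟩ := exists_rarely_changing hT hφ hφ01 hφa hsmall
    (ε := fun k => (2⁻¹ : ℝ≥0∞) ^ k / (ENNReal.ofReal (c k) + 1))
    fun k => ENNReal.div_pos (ENNReal.pow_pos (by simp) k).ne' (by simp)
  obtain ⟨e, he, hemap, heL⟩ := exists_realization ν hLm hLmono hLν hR hh hh01 hha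
    fun k => (hκν k).trans (hRμ k)
  have hTm : Measurable T := T.measurable
  have hw : Measurable fun ω => (R ω : ℝ) + h ω :=
    ((measurable_from_nat (f := fun n : ℕ => (n : ℝ))).comp hR).add hh
  set x : Ω → AnglePair := fun ω => e (R ω + h ω) with hx
  have hxm : Measurable x := he.comp hw
  set χ : Ω → ℝ := (x ⁻¹' L 0).indicator 1 with hχ
  have hχm : Measurable χ := measurable_one.indicator (hxm (hLm 0))
  have hχint : ∫ ω, χ ω ∂μ = p := by
    rw [hχ, integral_indicator_one (hxm (hLm 0)), hp, ← hemap,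
      map_measureReal_apply hxm (hLm 0)]
  set S : Set Ω := {ω | ¬(R (T ω) = R ω ∧ h (T ω) = h ω)} with hS
  have hSm : MeasurableSet S :=
    ((measurableSet_eq_fun (hR.comp hTm) hR).inter (measurableSet_eq_fun (hh.comp hTm) hh)).compl
  have hmm : Measurable fun ω => max (R ω) (R (T ω)) := hR.max (hR.comp hTm)
  set g : Ω → ℝ := fun ω =>
    max 0 (max (N 1) M) + S.indicator (fun ω => c (max (R ω) (R (T ω)))) ω with hg
  have hcg : Measurable (S.indicator fun ω => c (max (R ω) (R (T ω)))) :=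
    ((measurable_from_nat (f := c)).comp hmm).indicator hSm
  have hgm : Measurable g := measurable_const.add hcg
  have hc0 : ∀ k, 0 ≤ c k := fun k => le_max_left _ _
  have hind0 : ∀ ω, 0 ≤ S.indicator (fun ω => c (max (R ω) (R (T ω)))) ω :=
    Set.indicator_nonneg fun ω _ => hc0 _
  have hg0 : ∀ ω, 0 ≤ g ω := fun ω => add_nonneg (le_max_left _ _) (hind0 ω)
  have hgl : ∫⁻ ω, ENNReal.ofReal (g ω) ∂μ < ∞ := by
    have hsplit : ∀ ω, ENNReal.ofReal (g ω) = ENNReal.ofReal (max 0 (max (N 1) M)) +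
        ENNReal.ofReal (S.indicator (fun ω => c (max (R ω) (R (T ω)))) ω) := fun ω =>
      ENNReal.ofReal_add (le_max_left _ _) (hind0 ω)
    simp_rw [hsplit]
    rw [lintegral_add_left measurable_const]
    exact ENNReal.add_lt_top.2 ⟨by simp, lintegral_ofReal_indicator_lt_top hSm hmm hRh⟩
  have hgi : Integrable g μ :=
    (lintegral_ofReal_ne_top_iff_integrable hgm.aestronglyMeasurable (.of_forall hg0)).1 hgl.ne
  have hxS : ∀ ω, ω ∉ S → x (T ω) = x ω := fun ω hω => by
    obtain ⟨h1, h2⟩ := not_not.1 hω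
    simp only [hx, h1, h2]
  have hgS : ∀ ω ∈ S, c (max (R ω) (R (T ω))) ≤ g ω := fun ω hω => by
    simp only [hg, Set.indicator_of_mem hω]
    exact le_add_of_nonneg_left (le_max_left _ _)
  have heLT := hT.quasiMeasurePreserving.ae heL
  refine ⟨generator T x χ (r₁ / p) (r₂ / p), measurable_generator hxm hχm, ?_, ?_, ?_⟩
  · refine upperIntegral_lt_top_of_ae_le hgm.ennreal_ofReal hgl ?_
    filter_upwards [heL, heLT] with ω h1 h2
    refine ENNReal.ofReal_le_ofReal ?_
    -- At a change both pairs lie in `L (max (R ω) (R (T ω)) + 1)` and `c` applies. Otherwise `F ω`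
    -- fixes both lines: it is the identity outside `x ⁻¹' L 0` and is bounded by compactness
    -- inside.
    by_cases hω : ω ∈ S
    · refine le_trans ?_ (hgS ω hω)
      have h1' := hLmono (Nat.succ_le_succ (le_max_left (R ω) (R (T ω)))) h1
      have h2' := hLmono (Nat.succ_le_succ (le_max_right (R ω) (R (T ω)))) h2
      by_cases h0 : x ω ∈ L 0
      · have hχω : χ ω = 1 := Set.indicator_of_mem (show ω ∈ x ⁻¹' L 0 from h0) 1
        rw [generator, hχω, mul_one, mul_one]
        exact (hC₁ _ _ h1' _ h2').trans ((le_max_left _ _).trans (le_max_right _ _))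
      · have hχω : χ ω = 0 := Set.indicator_of_notMem (show ω ∉ x ⁻¹' L 0 from h0) 1
        rw [generator, hχω, mul_zero, mul_zero]
        exact (hC₀ _ _ h1' _ h2').trans
          ((le_max_left _ _).trans ((le_max_right _ _).trans (le_max_right _ _)))
    · refine le_trans ?_ (le_add_of_nonneg_right (hind0 ω))
      rw [generator, hxS ω hω]
      refine le_trans ?_ (le_max_right _ _)
      by_cases h0 : x ω ∈ L 0
      · have hχω : χ ω = 1 := Set.indicator_of_mem (show ω ∈ x ⁻¹' L 0 from h0) 1
        rw [hχω, mul_one, mul_one]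
        exact (hM _ h0 _ h0).trans (le_max_right _ _)
      · have hχω : χ ω = 0 := Set.indicator_of_notMem (show ω ∉ x ⁻¹' L 0 from h0) 1
        rw [hχω, mul_zero, mul_zero, transition_self_zero]
        exact le_max_left _ _
  · have hsub : ∀ᵐ ω ∂μ, ∀ j : ℕ, ∀ᶠ n : ℕ in atTop, g (T^[n] ω) ≤ 1 / ((j : ℝ) + 1) * n :=
      ae_all_iff.2 fun j =>
        ae_eventually_comp_iterate_le hT.toMeasurePreserving hgm hgi Nat.one_div_pos_of_nat
    have horb : ∀ᵐ ω ∂μ, ∀ n : ℕ, x (T (T^[n] ω)) ∈ L (R (T (T^[n] ω)) + 1) :=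
      ae_all_iff.2 fun n =>
        (hT.toMeasurePreserving.iterate n).quasiMeasurePreserving.ae heLT
    filter_upwards [hsub, horb, ae_tendsto_birkhoffSum_div hT hχm (C := 1) fun ω => by
      by_cases h : ω ∈ x ⁻¹' L 0 <;> simp [hχ, h]] with ω h1 h2 h3
    -- The angle changes only on `S`, and there its new value is controlled by `g`, which is
    -- integrable and hence sublinear along the orbit.
    have hsine : Tendsto (fun n : ℕ => -Real.log |(x (T^[n] ω)).sine| / n) atTop (𝓝 0) := by
      refine tendsto_div_zero_of_le_max (g := fun n => g (T^[n] ω))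
        (fun n => neg_log_abs_sine_nonneg _) (fun n => ?_) fun a ha => ?_
      · rw [Function.iterate_succ_apply']
        by_cases hω : T^[n] ω ∈ S
        · refine le_trans ?_ (le_max_right _ _)
          refine (neg_log_abs_sine_le (hLmono
            (Nat.succ_le_succ (le_max_right (R (T^[n] ω)) _)) (h2 n))).trans (le_trans ?_ (hgS _ hω))
          exact (le_max_right _ _).trans ((le_max_right _ _).trans (le_max_right _ _))
        · rw [hxS _ hω]
          exact le_max_left _ _
      · obtain ⟨j, hj⟩ := exists_nat_one_div_lt ha
        filter_upwards [h1 j] with n hn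
        exact hn.trans (mul_le_mul_of_nonneg_right hj.le (Nat.cast_nonneg n))
    have hrate : ∀ r : ℝ, Tendsto (fun n : ℕ => r / p * birkhoffSum T χ n ω / n) atTop (𝓝 r) :=
      fun r => by
        have := h3.const_mul (r / p)
        rw [hχint, div_mul_cancel₀ r hp0.ne'] at this
        exact this.congr fun n => (mul_div_assoc _ _ _).symm
    have hcoc : ∀ n : ℕ, cocycle T (generator T x χ (r₁ / p) (r₂ / p)) n ω =
        transition (x ω) (x (T^[n] ω)) (r₁ / p * birkhoffSum T χ n ω)
          (r₂ / p * birkhoffSum T χ n ω) := fun n => cocycleNat_generator n ω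
    simp_rw [hcoc, transition_inv, Real.log_inv]
    constructor
    · have := tendsto_log_glNorm_transition (x := fun _ => x ω) (y := fun n => x (T^[n] ω))
        (hrate r₁) (hrate r₂) (tendsto_const_div_atTop_nhds_zero_nat _)
      rwa [max_eq_left hr.le] at this
    -- The inverse starts from the moving pair `x (T^[n] ω)`, so `hsine` is needed here, whereas the
    -- forward norm involves only the fixed pair `x ω`.
    · have hneg : ∀ r : ℝ,
          Tendsto (fun n : ℕ => -(r / p * birkhoffSum T χ n ω) / n) atTop (𝓝 (-r)) := fun r =>
        (hrate r).neg.congr fun n => (neg_div _ _).symm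
      have := (tendsto_log_glNorm_transition (x := fun n => x (T^[n] ω)) (y := fun _ => x ω)
        (hneg r₁) (hneg r₂) hsine).neg
      rw [max_eq_right (neg_le_neg hr.le), neg_neg] at this
      exact this.congr fun n => (mul_neg _ _).symm
  · refine ⟨fun ω => (x ω).lines, AnglePair.continuous_lines.measurable.comp hxm, ?_, ?_⟩
    · filter_upwards [ae_tendsto_intBirkhoffSum_div hT hχm (C := 1) fun ω => by
        by_cases h : ω ∈ x ⁻¹' L 0 <;> simp [hχ, h]] with ω hω
      have hrate : ∀ r : ℝ, Tendsto (fun n : ℤ => r / p * intBirkhoffSum T χ ω n / n)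
          (atBot ⊔ atTop) (𝓝 r) := fun r => by
        have := hω.const_mul (r / p)
        rw [hχint, div_mul_cancel₀ r hp0.ne'] at this
        exact this.congr fun n => (mul_div_assoc _ _ _).symm
      exact oseledetsSpace_eq_span hr (fun n => cocycle_generator n ω) (hrate r₁) (hrate r₂)
    · have h1 : μ.map (fun ω => (x ω).lines) = (μ.map x).map AnglePair.lines :=
        (Measure.map_map AnglePair.continuous_lines.measurable hxm).symm
      rw [h1, hemap, hν, Measure.map_map AnglePair.continuous_lines.measurable
        LinePairs.measurable_angles]
      have h2 : AnglePair.lines ∘ LinePairs.angles = id := funext LinePairs.lines_angles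
      rw [h2, Measure.map_id]
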